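/- Let $\Bbbk$ be a field of characteristic $0$. We use $\mathbb{S}$-modules in the coordinate-free form: a reduced $\mathbb{S}$-module $P$ is a functor from the groupoid of finite sets and bijections to $\Bbbk$-vector spaces with $P(\emptyset)=0$; the composite product is $(P\circ Q)(S)=\bigoplus_{\pi} P(\pi)\otimes\bigotimes_{B\in\pi}Q(B)$, the sum being over all partitions $\pi$ of $S$; its unit $I$ is $\Bbbk$ on one-element sets and $0$ elsewhere. An operad is a monoid $(P,\gamma_P,\eta_P)$ for $\circ$. For $a\in S$, its partial composition $\circ_a\colon P(S)\otimes P(T)\to P((S\setminus\{a\})\sqcup T)$, with $T\neq\emptyset$, is the composition with an element of $P(T)$ at $a$ and with the operadic unit at all other inputs. A directed simple non-necessarily connected graph on a non-empty finite set $S$ of vertices is a directed graph without directed cycles (it is directed by a global flow) and with at most one edge between two vertices. Let $\mathsf{dsncGra}(S)$ be the set of these graphs and $\mathsf{dsGra}(S)\subset\mathsf{dsncGra}(S)$ the subset of the connected ones. For $\mathrm g\in\mathsf{dsncGra}(S)$, $\mathrm h\in\mathsf{dsncGra}(T)$ and $a\in S$, let $\mathrm g\circ_a\mathrm h$ be the sum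 of all the graphs on $(S\setminus\{a\})\sqcup T$ that are obtained by inserting $\mathrm h$ at the vertex $a$ of $\mathrm g$ and joining each vertex of $\mathrm g$ that was attached to $a$, in the same direction, to the vertices of $\mathrm h$ in all possible ways with at least one edge. Let $\mathrm{Com}$ be the operad with $\mathrm{Com}(S)=\Bbbk$, with trivial action, for every non-empty $S$, in which every composite of generators is the generator. **Proposition.** 1. The graphs form an operad $\mathrm{Lie}\text{-}\mathrm{ncgra}=(\Bbbk\,\mathsf{dsncGra},\{\circ_a\},\bullet)$: there is an operad structure on $S\mapsto\Bbbk\,\mathsf{dsncGra}(S)$ whose partial compositions are the above products $\circ_a$ and whose unit is the one-vertex graph. Its total composition sends a graph $\mathrm g$ on the set of blocks of a partition and graphs $\mathrm h_B$ on the blocks $B$ to the sum of all the graphs obtained by inserting every $\mathrm h_B$ at the vertex $B$ and replacing every edge $B\to B'$ of $\mathrm g$, in all possible ways, by a non-empty set of edges from vertices of $\mathrm h_B$ to vertices of $\mathrm h_{B'}$. With the same composition and unit the connected graphs form an operad $\mathrm{Lie}\text{-}\mathrm{gra}=\Bbbk\,\mathsf{dsGra}$, and the inclusion $\mathrm{Lie}\text{-}\mathrm{gra}\to\mathrm{Lie}\text{-}\mathrm{ncgra}$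 is an injective morphism of operads. 2. Sending the generator of $\mathrm{Com}(S)$ to the graph on $S$ without edges is an injective morphism of operads $\mathrm{Com}\to\mathrm{Lie}\text{-}\mathrm{ncgra}$. 3. Let $\Phi\colon\mathrm{Com}\circ\mathrm{Lie}\text{-}\mathrm{gra}\to\mathrm{Lie}\text{-}\mathrm{ncgra}$ and $\Psi\colon\mathrm{Lie}\text{-}\mathrm{gra}\circ\mathrm{Com}\to\mathrm{Lie}\text{-}\mathrm{ncgra}$ be the maps obtained from these two inclusions and the composition of $\mathrm{Lie}\text{-}\mathrm{ncgra}$. There is a map of $\mathbb S$-modules $$\Lambda\colon \mathrm{Lie}\text{-}\mathrm{gra}\circ\mathrm{Com}\longrightarrow\mathrm{Com}\circ\mathrm{Lie}\text{-}\mathrm{gra}\qquad\text{with}\qquad \Phi\Lambda=\Psi,$$ and it is a distributive law: with $P=\mathrm{Com}$ and $Q=\mathrm{Lie}\text{-}\mathrm{gra}$, and up to the associativity and unit isomorphisms of $\circ$, $$\Lambda(\mathrm{id}\circ\gamma_P)=(\gamma_P\circ\mathrm{id})(\mathrm{id}\circ\Lambda)(\Lambda\circ\mathrm{id}),\qquad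 \Lambda(\gamma_Q\circ\mathrm{id})=(\mathrm{id}\circ\gamma_Q)(\Lambda\circ\mathrm{id})(\mathrm{id}\circ\Lambda),$$ $$\Lambda(\eta_Q\circ\mathrm{id})=\mathrm{id}\circ\eta_Q,\qquad \Lambda(\mathrm{id}\circ\eta_P)=\eta_P\circ\mathrm{id}.$$ 4. The $\mathbb S$-module $\mathrm{Com}\circ\mathrm{Lie}\text{-}\mathrm{gra}$ with the composition $(\gamma_P\circ\gamma_Q)(\mathrm{id}\circ\Lambda\circ\mathrm{id})$ and the unit $\eta_P\circ\eta_Q$ is an operad, and $\Phi$ is an isomorphism of operads from it to $\mathrm{Lie}\text{-}\mathrm{ncgra}$. -/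

import Mathlib

namespace GraphOperad

universe u

open scoped TensorProduct DirectSum Classical

noncomputable section

/-- The fibre of a map `f` over `j`. -/
abbrev Fib {S K : Type} (f : S → K) (j : K) : Type := {s : S // f s = j}

/-- A bijection between two fibres induced by a bijection of the ambient sets. -/
abbrev fibEquiv {S T K K' : Type} {f : S → K} {g : T → K'} {j : K} {j' : K'} (e : S ≃ T)
    (h : ∀ s, f s = j ↔ g (e s) = j') : Fib f j ≃ Fib g j' :=
  e.subtypeEquiv h

/-- A reduced `𝕊`-module in `k`-vector spaces, written as a functor from the groupoid of finite
sets and bijections to `k`-vector spaces; reduced means that the arity `0` component vanishes. -/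
structure SMod (k : Type u) [Field k] where
  obj : (S : Type) → [Finite S] → Type u
  [addCommGroup : ∀ (S : Type) [Finite S], AddCommGroup (obj S)]
  [module : ∀ (S : Type) [Finite S], Module k (obj S)]
  map : ∀ {S T : Type} [Finite S] [Finite T], (S ≃ T) → (obj S →ₗ[k] obj T)
  map_refl : ∀ (S : Type) [Finite S] (x : obj S), map (Equiv.refl S) x = x
  map_trans : ∀ {S T U : Type} [Finite S] [Finite T] [Finite U] (e : S ≃ T) (e' : T ≃ U)
    (x : obj S), map (e.trans e') x = map e' (map e x)
  reduced : ∀ (S : Type) [Finite S] [IsEmpty S], Subsingleton (obj S)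

attribute [instance] SMod.addCommGroup SMod.module

variable {k : Type u} [Field k]

namespace SMod

/-- The action of a bijection as a linear equivalence. -/
def mapEquiv (P : SMod k) {S T : Type} [Finite S] [Finite T] (e : S ≃ T) :
    P.obj S ≃ₗ[k] P.obj T :=
  LinearEquiv.ofLinearMap (P.map e) (P.map e.symm)
    (LinearMap.ext fun x => by simp [← P.map_trans, P.map_refl])
    (LinearMap.ext fun x => by simp [← P.map_trans, P.map_refl])

@[simp] theorem mapEquiv_apply (P : SMod k) {S T : Type} [Finite S] [Finite T] (e : S ≃ T)
    (x : P.obj S) : P.mapEquiv e x = P.map e x := rfl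

/-- The summand of `(P ∘ Q)(S)` that belongs to the partition of `S` into the classes of `r`. -/
abbrev Summand (P Q : SMod k) (S : Type) [Finite S] (r : Setoid S) : Type u :=
  P.obj (Quotient r) ⊗[k] (⨂[k] b : Quotient r, Q.obj (Fib (Quotient.mk r) b))

/-- The vector space `(P ∘ Q)(S) = ⨁_r P(S/r) ⊗ ⨂_{b ∈ S/r} Q(b)`, the sum being over all
partitions of `S`. -/
abbrev compObj (P Q : SMod k) (S : Type) [Finite S] : Type u :=
  ⨁ r : Setoid S, Summand P Q S r

/-- The identification of `P(K) ⊗ ⨂_{j ∈ K} Q(f⁻¹(j))`, for a surjection `f : S → K`, with the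
summand of `(P ∘ Q)(S)` for the partition of `S` into the fibres of `f`. -/
def toSummand (P Q : SMod k) {S K : Type} [Finite S] [Finite K] (f : S → K)
    (hf : Function.Surjective f) :
    (P.obj K ⊗[k] (⨂[k] j : K, Q.obj (Fib f j))) ≃ₗ[k] Summand P Q S (Setoid.ker f) :=
  TensorProduct.congr (P.mapEquiv (Setoid.quotientKerEquivOfSurjective f hf).symm)
    (PiTensorProduct.reindex k (fun j => Q.obj (Fib f j))
        (Setoid.quotientKerEquivOfSurjective f hf).symm ≪≫ₗ
      PiTensorProduct.congr fun b => Q.mapEquiv (fibEquiv (Equiv.refl S) (fun s => by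
        rw [Equiv.symm_symm, ← (Setoid.quotientKerEquivOfSurjective f hf).injective.eq_iff]
        rfl)))

/-- The element of `(P ∘ Q)(S)` given by a surjection `f : S → K` and decorations
`p ∈ P(K)`, `q ∈ ⨂_{j ∈ K} Q(f⁻¹(j))`, as a bilinear map. -/
def mkL (P Q : SMod k) {S K : Type} [Finite S] [Finite K] (f : S → K)
    (hf : Function.Surjective f) :
    P.obj K →ₗ[k] (⨂[k] j : K, Q.obj (Fib f j)) →ₗ[k] compObj P Q S :=
  TensorProduct.curry (DirectSum.lof k (Setoid S) (Summand P Q S) (Setoid.ker f) ∘ₗ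
    (toSummand P Q f hf).toLinearMap)

/-- The two-level tree with root decoration `p` and upper decorations `q j`. -/
def tree {P Q : SMod k} {S K : Type} [Finite S] [Finite K] (f : S → K)
    (hf : Function.Surjective f) (p : P.obj K) (q : ∀ j : K, Q.obj (Fib f j)) : compObj P Q S :=
  mkL P Q f hf p (PiTensorProduct.tprod k q)

section lemmas

variable {P Q : SMod k}

theorem lof_tree_aux {S : Type} [Finite S] {r r' : Setoid S} (σ : Quotient r ≃ Quotient r')
    (hσ : ∀ s, σ (Quotient.mk r s) = Quotient.mk r' s)
    {p : P.obj (Quotient r)} {p' : P.obj (Quotient r')} (hp : P.map σ p = p')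
    {q : ∀ b, Q.obj (Fib (Quotient.mk r) b)} {q' : ∀ b, Q.obj (Fib (Quotient.mk r') b)}
    (hq : ∀ b, Q.map (fibEquiv (Equiv.refl S) (fun s => by
      rw [← σ.injective.eq_iff, hσ]; rfl)) (q b) = q' (σ b)) :
    DirectSum.lof k (Setoid S) (Summand P Q S) r (p ⊗ₜ PiTensorProduct.tprod k q) =
      DirectSum.lof k (Setoid S) (Summand P Q S) r' (p' ⊗ₜ PiTensorProduct.tprod k q') := by
  obtain rfl : r = r' := by
    ext x y
    have h1 := Quotient.eq (r := r) (x := x) (y := y)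
    have h2 := Quotient.eq (r := r') (x := x) (y := y)
    have h3 := σ.injective.eq_iff (a := Quotient.mk r x) (b := Quotient.mk r y)
    rw [hσ, hσ] at h3
    exact h1.symm.trans (h3.symm.trans h2)
  obtain rfl : σ = Equiv.refl _ := by
    ext b
    induction b using Quotient.inductionOn with
    | h s => exact hσ s
  rw [P.map_refl] at hp
  have : q = q' := by
    funext b
    rw [← show _ = q' b from hq b]
    exact (Q.map_refl _ _).symm
  rw [hp, this]

theorem tree_eq_lof {S K : Type} [Finite S] [Finite K] (f : S → K)
    (hf : Function.Surjective f) (p : P.obj K) (q : ∀ j : K, Q.obj (Fib f j)) :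
    tree f hf p q = DirectSum.lof k (Setoid S) (Summand P Q S) (Setoid.ker f)
      (P.map (Setoid.quotientKerEquivOfSurjective f hf).symm p ⊗ₜ PiTensorProduct.tprod k
        fun b => Q.map (fibEquiv (Equiv.refl S) (fun s => by
          rw [← (Setoid.quotientKerEquivOfSurjective f hf).injective.eq_iff]
          rfl)) (q (Setoid.quotientKerEquivOfSurjective f hf b))) := by
  simp only [tree, mkL, toSummand, TensorProduct.curry_apply, LinearMap.comp_apply,
    LinearEquiv.coe_coe, TensorProduct.congr_tmul, LinearEquiv.trans_apply,
    PiTensorProduct.reindex_tprod, PiTensorProduct.congr_tprod, mapEquiv_apply, Equiv.symm_symm]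

theorem map_fib_eq {S K : Type} [Finite S] {f : S → K} (q : ∀ j : K, Q.obj (Fib f j))
    {j j' : K} (h : j = j') {T : Type} [Finite T] (e : Fib f j ≃ T) (e' : Fib f j' ≃ T)
    (he : ∀ s h1 h2, e ⟨s, h1⟩ = e' ⟨s, h2⟩) : Q.map e (q j) = Q.map e' (q j') := by
  subst h
  congr 1
  congr 1
  ext ⟨s, hs⟩
  exact he s hs hs

/-- Relabelling the middle level of a two-level tree. -/
theorem tree_congr {S K K' : Type} [Finite S] [Finite K] [Finite K'] {f : S → K} {f' : S → K'}
    (hf : Function.Surjective f) (hf' : Function.Surjective f') (σ : K ≃ K')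
    (hσ : ∀ s, σ (f s) = f' s) {p : P.obj K} {p' : P.obj K'} (hp : P.map σ p = p')
    {q : ∀ j, Q.obj (Fib f j)} {q' : ∀ j, Q.obj (Fib f' j)}
    (hq : ∀ j, Q.map (fibEquiv (Equiv.refl S) (fun s => by
      rw [← σ.injective.eq_iff, hσ]; rfl)) (q j) = q' (σ j)) :
    tree f hf p q = tree f' hf' p' q' := by
  rw [tree_eq_lof, tree_eq_lof]
  refine lof_tree_aux (((Setoid.quotientKerEquivOfSurjective f hf).trans σ).trans
    (Setoid.quotientKerEquivOfSurjective f' hf').symm) (fun s => ?_) ?_ (fun b => ?_)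
  · rw [Equiv.trans_apply, Equiv.symm_apply_eq]
    exact hσ s
  · rw [← hp, ← P.map_trans, ← P.map_trans]
    congr 1
    congr 1
    ext x
    simp
  · have hb : Setoid.quotientKerEquivOfSurjective f' hf'
        ((((Setoid.quotientKerEquivOfSurjective f hf).trans σ).trans
          (Setoid.quotientKerEquivOfSurjective f' hf').symm) b) =
        σ (Setoid.quotientKerEquivOfSurjective f hf b) := by simp
    rw [map_fib_eq q' hb _ (fibEquiv (Equiv.refl S) (fun s => by
      rw [← hb, (Setoid.quotientKerEquivOfSurjective f' hf').injective.eq_iff.symm]; rfl))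
      (fun s h1 h2 => rfl), ← hq, ← Q.map_trans, ← Q.map_trans]
    rfl

theorem tree_mk {S : Type} [Finite S] (r : Setoid S) (p : P.obj (Quotient r))
    (q : ∀ b, Q.obj (Fib (Quotient.mk r) b)) :
    tree (Quotient.mk r) Quotient.mk_surjective p q =
      DirectSum.lof k (Setoid S) (Summand P Q S) r (p ⊗ₜ PiTensorProduct.tprod k q) := by
  rw [tree_eq_lof]
  refine lof_tree_aux (Setoid.quotientKerEquivOfSurjective (Quotient.mk r) Quotient.mk_surjective)
    (fun s => rfl) ?_ (fun b => ?_)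
  · rw [← P.map_trans]
    simp [P.map_refl]
  · rw [← Q.map_trans]
    exact Q.map_refl _ _

/-- Linear maps out of `(P ∘ Q)(S)` are determined by their values on two-level trees. -/
theorem comp_hom_ext {S : Type} [Finite S] {M : Type*} [AddCommGroup M] [Module k M]
    {φ ψ : compObj P Q S →ₗ[k] M}
    (h : ∀ (r : Setoid S) (p : P.obj (Quotient r)) (q : ∀ b, Q.obj (Fib (Quotient.mk r) b)),
      φ (tree (Quotient.mk r) Quotient.mk_surjective p q) =
        ψ (tree (Quotient.mk r) Quotient.mk_surjective p q)) : φ = ψ := by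
  refine DirectSum.linearMap_ext _ fun r => TensorProduct.ext (LinearMap.ext fun p =>
    PiTensorProduct.ext (MultilinearMap.ext fun q => ?_))
  have := h r p q
  rw [tree_mk] at this
  exact this

/-- Relabelling the leaves of two-level trees. -/
def compMap (P Q : SMod k) {S T : Type} [Finite S] [Finite T] (e : S ≃ T) :
    compObj P Q S →ₗ[k] compObj P Q T :=
  DirectSum.toModule k (Setoid S) _ fun r => TensorProduct.lift
    ((mkL P Q (Quotient.mk r ∘ e.symm)
        (Quotient.mk_surjective.comp e.symm.surjective)).compl₂
      (PiTensorProduct.map fun b => Q.map (fibEquiv e (fun s => by simp))))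

theorem compMap_tree {S T K : Type} [Finite S] [Finite T] [Finite K] (e : S ≃ T) (f : S → K)
    (hf : Function.Surjective f) (p : P.obj K) (q : ∀ j : K, Q.obj (Fib f j)) :
    compMap P Q e (tree f hf p q) = tree (f ∘ e.symm) (hf.comp e.symm.surjective) p
      fun j => Q.map (fibEquiv e (fun s => by simp)) (q j) := by
  rw [tree_eq_lof, compMap, DirectSum.toModule_lof, TensorProduct.lift.tmul, LinearMap.compl₂_apply,
    PiTensorProduct.map_tprod]
  refine tree_congr (Quotient.mk_surjective.comp e.symm.surjective) _
    (Setoid.quotientKerEquivOfSurjective f hf) (fun s => rfl) ?_ (fun b => ?_)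
  · rw [← P.map_trans]
    simp [P.map_refl]
  · rw [← Q.map_trans, ← Q.map_trans]
    rfl

/-- The composite product `P ∘ Q` of reduced `𝕊`-modules. -/
abbrev comp (P Q : SMod k) : SMod k where
  obj S _ := compObj P Q S
  map e := compMap P Q e
  map_refl S _ x := by
    refine LinearMap.congr_fun (f := compMap P Q (Equiv.refl S)) (g := LinearMap.id)
      (comp_hom_ext fun r p q => ?_) x
    rw [compMap_tree]
    congr 1
    funext j
    exact Q.map_refl _ _
  map_trans e e' x := by
    refine LinearMap.congr_fun (f := compMap P Q (e.trans e'))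
      (g := compMap P Q e' ∘ₗ compMap P Q e) (comp_hom_ext fun r p q => ?_) x
    rw [LinearMap.comp_apply, compMap_tree, compMap_tree, compMap_tree]
    congr 1
    funext j
    rw [← Q.map_trans]
    rfl
  reduced S _ _ := by
    have (r : Setoid S) : Subsingleton (Summand P Q S r) := by
      have : IsEmpty (Quotient r) := by exact ⟨fun b => isEmptyElim b.out⟩
      have := P.reduced (Quotient r)
      refine ⟨fun x y => ?_⟩
      have hz : ∀ z : Summand P Q S r, z = 0 := fun z => by
        induction z using TensorProduct.induction_on with
        | zero => rfl
        | tmul a b => rw [Subsingleton.elim a 0, TensorProduct.zero_tmul]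
        | add a b ha hb => rw [ha, hb, add_zero]
      rw [hz x, hz y]
    exact ⟨fun x y => DFinsupp.ext fun r => Subsingleton.elim _ _⟩

end lemmas

/- Multilinear algebra used for the associator -/

section linear

variable {K L : Type}

theorem group_aux (g : K → L) (M : K → Type u) [∀ j, AddCommGroup (M j)] [∀ j, Module k (M j)]
    [DecidableEq K] (m : ∀ j, M j) (j : K) (z : M j) :
    (fun l => PiTensorProduct.tprod k fun d : Fib g l => Function.update m j z d.1) =
      Function.update (fun l => PiTensorProduct.tprod k fun d : Fib g l => m d.1) (g j)
        (PiTensorProduct.tprod k (Function.update (fun d : Fib g (g j) => m d.1) ⟨j, rfl⟩ z)) := by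
  funext l
  by_cases hl : l = g j
  · subst hl
    rw [Function.update_self]
    congr 1
    funext d
    by_cases hd : d = ⟨j, rfl⟩
    · subst hd; simp
    · rw [Function.update_of_ne hd, Function.update_of_ne (fun h => hd (Subtype.ext h))]
  · rw [Function.update_of_ne hl]
    congr 1
    funext d
    refine Function.update_of_ne (fun h => hl ?_) _ _
    rw [← h]; exact d.2.symm

/-- The grouping map `⨂_{j ∈ K} M j → ⨂_{l ∈ L} ⨂_{j ∈ g⁻¹(l)} M j`. -/
def group (g : K → L) (M : K → Type u) [∀ j, AddCommGroup (M j)] [∀ j, Module k (M j)] :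
    (⨂[k] j, M j) →ₗ[k] ⨂[k] l : L, ⨂[k] d : Fib g l, M d.1 :=
  PiTensorProduct.lift
    { toFun := fun m => PiTensorProduct.tprod k fun l =>
        PiTensorProduct.tprod k fun d : Fib g l => m d.1
      map_update_add' := by
        intro _ m j x y
        convert_to PiTensorProduct.tprod k (fun l => PiTensorProduct.tprod k
            fun d : Fib g l => Function.update m j (x + y) d.1) =
          PiTensorProduct.tprod k (fun l => PiTensorProduct.tprod k
            fun d : Fib g l => Function.update m j x d.1) +
          PiTensorProduct.tprod k (fun l => PiTensorProduct.tprod k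
            fun d : Fib g l => Function.update m j y d.1)
        rw [group_aux, group_aux, group_aux, MultilinearMap.map_update_add, MultilinearMap.map_update_add]
      map_update_smul' := by
        intro _ m j c x
        convert_to PiTensorProduct.tprod k (fun l => PiTensorProduct.tprod k
            fun d : Fib g l => Function.update m j (c • x) d.1) =
          c • PiTensorProduct.tprod k (fun l => PiTensorProduct.tprod k
            fun d : Fib g l => Function.update m j x d.1)
        rw [group_aux, group_aux, MultilinearMap.map_update_smul, MultilinearMap.map_update_smul] }

@[simp] theorem group_tprod (g : K → L) (M : K → Type u) [∀ j, AddCommGroup (M j)]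
    [∀ j, Module k (M j)] (m : ∀ j, M j) :
    group (k := k) g M (PiTensorProduct.tprod k m) =
      PiTensorProduct.tprod k fun l => PiTensorProduct.tprod k fun d : Fib g l => m d.1 :=
  PiTensorProduct.lift.tprod _

theorem bijective_of_basis {ι ι' : Type*} {V W : Type*} [AddCommGroup V] [Module k V]
    [AddCommGroup W] [Module k W] (b : Module.Basis ι k V) (b' : Module.Basis ι' k W)
    (e : ι ≃ ι') (φ : V →ₗ[k] W) (h : ∀ i, φ (b i) = b' (e i)) : Function.Bijective φ := by
  have : φ = (b.equiv b' e).toLinearMap := b.ext fun i => by simp [h]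
  rw [this]
  exact (b.equiv b' e).bijective

theorem group_bijective [Finite K] [Finite L] (g : K → L) (M : K → Type u) [∀ j, AddCommGroup (M j)]
    [∀ j, Module k (M j)] : Function.Bijective (group (k := k) g M) := by
  let b := fun j => Module.Basis.ofVectorSpace k (M j)
  refine bijective_of_basis (Basis.piTensorProduct b)
    (Basis.piTensorProduct fun l => Basis.piTensorProduct fun d : Fib g l => b d.1)
    { toFun := fun p l d => p d.1
      invFun := fun p j => p (g j) ⟨j, rfl⟩
      left_inv := fun p => rfl
      right_inv := fun p => by
        funext l d
        obtain ⟨d, rfl⟩ := d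
        rfl } _ fun p => ?_
  simp

/-- The map `(⨂ A_l) ⊗ (⨂ B_l) → ⨂ (A_l ⊗ B_l)`. -/
def zip (A B : L → Type u) [∀ j, AddCommGroup (A j)] [∀ j, Module k (A j)]
    [∀ j, AddCommGroup (B j)] [∀ j, Module k (B j)] :
    (⨂[k] l, A l) ⊗[k] (⨂[k] l, B l) →ₗ[k] ⨂[k] l, (A l ⊗[k] B l) :=
  TensorProduct.lift (PiTensorProduct.map₂ fun l => TensorProduct.mk k (A l) (B l))

theorem zip_bijective [Finite L] (A B : L → Type u) [∀ j, AddCommGroup (A j)] [∀ j, Module k (A j)]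
    [∀ j, AddCommGroup (B j)] [∀ j, Module k (B j)] :
    Function.Bijective (zip (k := k) A B) := by
  let a := fun j => Module.Basis.ofVectorSpace k (A j)
  let b := fun j => Module.Basis.ofVectorSpace k (B j)
  refine bijective_of_basis ((Basis.piTensorProduct a).tensorProduct (Basis.piTensorProduct b))
    (Basis.piTensorProduct fun l => (a l).tensorProduct (b l))
    { toFun := fun p l => (p.1 l, p.2 l)
      invFun := fun p => (fun l => (p l).1, fun l => (p l).2)
      left_inv := fun p => rfl
      right_inv := fun p => rfl } _ fun p => ?_
  rw [Module.Basis.tensorProduct_apply']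
  simp [zip, PiTensorProduct.map₂_tprod_tprod]

theorem tensor_ext {A M : Type*} {B : L → Type*} {C : K → Type*} [AddCommMonoid A] [Module k A]
    [∀ l, AddCommMonoid (B l)] [∀ l, Module k (B l)] [∀ j, AddCommMonoid (C j)]
    [∀ j, Module k (C j)] [AddCommMonoid M] [Module k M]
    {φ ψ : (A ⊗[k] (⨂[k] l, B l)) ⊗[k] (⨂[k] j, C j) →ₗ[k] M}
    (h : ∀ a b c, φ ((a ⊗ₜ PiTensorProduct.tprod k b) ⊗ₜ PiTensorProduct.tprod k c) =
      ψ ((a ⊗ₜ PiTensorProduct.tprod k b) ⊗ₜ PiTensorProduct.tprod k c)) : φ = ψ :=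
  TensorProduct.ext (TensorProduct.ext (LinearMap.ext fun p =>
    PiTensorProduct.ext (MultilinearMap.ext fun q => PiTensorProduct.ext
      (MultilinearMap.ext fun x => h p q x))))

theorem directSum_bijective {ι κ : Type*} {M : ι → Type*} {N : κ → Type*}
    [DecidableEq ι] [DecidableEq κ] [∀ i, AddCommMonoid (M i)] [∀ i, Module k (M i)] [∀ i, AddCommMonoid (N i)]
    [∀ i, Module k (N i)] (φ : (⨁ i, M i) →ₗ[k] ⨁ j, N j) (σ : ι ≃ κ)
    (e : ∀ i, M i ≃ₗ[k] N (σ i))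
    (h : ∀ i x, φ (DirectSum.lof k ι M i x) = DirectSum.lof k κ N (σ i) (e i x)) :
    Function.Bijective φ := by
  have : φ = ((DFinsupp.mapRange.linearEquiv e : (⨁ i, M i) ≃ₗ[k] ⨁ i, N (σ i)) ≪≫ₗ
      (DirectSum.lequivCongrLeft k (M := N) σ.symm).symm).toLinearMap := by
    refine DirectSum.linearMap_ext _ fun i => LinearMap.ext fun x => ?_
    rw [LinearMap.comp_apply, h, LinearMap.comp_apply, LinearEquiv.coe_coe,
      LinearEquiv.trans_apply, LinearEquiv.eq_symm_apply]
    have h1 : (DFinsupp.mapRange.linearEquiv e : (⨁ i, M i) ≃ₗ[k] ⨁ i, N (σ i))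
        (DirectSum.lof k ι M i x) = DirectSum.lof k ι (fun i => N (σ i)) i (e i x) :=
      DFinsupp.mapRange_single (hf := fun i => map_zero (e i))
    rw [h1]
    exact DirectSum.lequivCongrLeft_lof k (e := σ.symm) (by simp) _ _ rfl
  rw [this]
  exact LinearEquiv.bijective _

theorem decomp_bijective {ι κ : Type*} {M : ι → Type*} {N : κ → Type*} {A B : Type*}
    [DecidableEq ι] [DecidableEq κ] [∀ i, AddCommMonoid (M i)] [∀ i, Module k (M i)]
    [∀ i, AddCommMonoid (N i)] [∀ i, Module k (N i)] [AddCommMonoid A] [Module k A]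
    [AddCommMonoid B] [Module k B] (φ : A →ₗ[k] B) (E : A ≃ₗ[k] ⨁ i, M i)
    (F : B ≃ₗ[k] ⨁ j, N j) (σ : ι ≃ κ) (e : ∀ i, M i ≃ₗ[k] N (σ i))
    (h : ∀ i x, F (φ (E.symm (DirectSum.lof k ι M i x))) =
      DirectSum.lof k κ N (σ i) (e i x)) :
    Function.Bijective φ := by
  have h1 : Function.Bijective (F ∘ φ ∘ E.symm) :=
    directSum_bijective (F.toLinearMap ∘ₗ φ ∘ₗ E.symm.toLinearMap) σ e h
  rwa [Function.Bijective.of_comp_iff' F.bijective,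
    Function.Bijective.of_comp_iff _ E.symm.bijective] at h1

end linear

section decomp

variable {ι : Type} (A : ι → Type u) [∀ i, AddCommMonoid (A i)] [∀ i, Module k (A i)]

theorem mapRange_lof {M N : ι → Type u} [∀ i, AddCommMonoid (M i)] [∀ i, Module k (M i)]
    [∀ i, AddCommMonoid (N i)] [∀ i, Module k (N i)] (e : ∀ i, M i ≃ₗ[k] N i) (i : ι) (x : M i) :
    (DFinsupp.mapRange.linearEquiv e : (⨁ i, M i) ≃ₗ[k] ⨁ i, N i)
      (DirectSum.lof k ι M i x) = DirectSum.lof k ι N i (e i x) :=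
  DFinsupp.mapRange_single (hf := fun i => map_zero (e i))

theorem sigma_lof {κ : ι → Type} (M : ∀ i, κ i → Type u) [∀ i v, AddCommMonoid (M i v)]
    [∀ i v, Module k (M i v)] (i : ι) (v : κ i) (x : M i v) :
    (DirectSum.sigmaLcurryEquiv k (δ := M)).symm
      (DirectSum.lof k ι (fun i => ⨁ v, M i v) i (DirectSum.lof k (κ i) (M i) v x)) =
      DirectSum.lof k (Σ i, κ i) (fun a => M a.1 a.2) ⟨i, v⟩ x :=
  DFinsupp.sigmaUncurry_single i v x

/-- Distributing tensor products over nested direct sums. -/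
def leftSum {κ : ι → Type} (N : ∀ i, κ i → Type u) [∀ i v, AddCommMonoid (N i v)]
    [∀ i v, Module k (N i v)] :
    (⨁ i, (⨁ v : κ i, N i v) ⊗[k] A i) ≃ₗ[k] ⨁ a : (Σ i, κ i), N a.1 a.2 ⊗[k] A a.1 :=
  (DFinsupp.mapRange.linearEquiv fun i => TensorProduct.directSumLeft k k (N i) (A i)) ≪≫ₗ
  (DirectSum.sigmaLcurryEquiv k (δ := fun i v => N i v ⊗[k] A i)).symm

theorem leftSum_lof {κ : ι → Type} (N : ∀ i, κ i → Type u) [∀ i v, AddCommMonoid (N i v)]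
    [∀ i v, Module k (N i v)] (i : ι) (v : κ i) (x : N i v) (y : A i) :
    leftSum (k := k) A N (DirectSum.lof k ι (fun i => (⨁ v : κ i, N i v) ⊗[k] A i) i
      (DirectSum.lof k _ (N i) v x ⊗ₜ y)) =
      DirectSum.lof k (Σ i, κ i) (fun a => N a.1 a.2 ⊗[k] A a.1) ⟨i, v⟩ (x ⊗ₜ y) := by
  rw [leftSum, LinearEquiv.trans_apply, mapRange_lof, TensorProduct.directSumLeft_tmul_lof]
  exact sigma_lof (fun i v => N i v ⊗[k] A i) i v _

/-- Distributing tensor products over nested direct sums. -/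
def rightSum {κ : ι → Type} (N : ∀ i, κ i → Type u) [∀ i v, AddCommMonoid (N i v)]
    [∀ i v, Module k (N i v)] :
    (⨁ i, A i ⊗[k] (⨁ v : κ i, N i v)) ≃ₗ[k] ⨁ a : (Σ i, κ i), A a.1 ⊗[k] N a.1 a.2 :=
  (DFinsupp.mapRange.linearEquiv fun i => TensorProduct.directSumRight k k (A i) (N i)) ≪≫ₗ
  (DirectSum.sigmaLcurryEquiv k (δ := fun i v => A i ⊗[k] N i v)).symm

theorem rightSum_lof {κ : ι → Type} (N : ∀ i, κ i → Type u) [∀ i v, AddCommMonoid (N i v)]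
    [∀ i v, Module k (N i v)] (i : ι) (v : κ i) (x : N i v) (y : A i) :
    rightSum (k := k) A N (DirectSum.lof k ι (fun i => A i ⊗[k] (⨁ v : κ i, N i v)) i
      (y ⊗ₜ DirectSum.lof k _ (N i) v x)) =
      DirectSum.lof k (Σ i, κ i) (fun a => A a.1 ⊗[k] N a.1 a.2) ⟨i, v⟩ (y ⊗ₜ x) := by
  rw [rightSum, LinearEquiv.trans_apply, mapRange_lof, TensorProduct.directSumRight_tmul_lof]
  exact sigma_lof (fun i v => A i ⊗[k] N i v) i v _

/-- Distributing tensor products over nested direct sums. -/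
def rightPiSum {J : ι → Type} [∀ i, Finite (J i)] {κ : ∀ i, J i → Type}
    (N : ∀ i (c : J i), κ i c → Type u) [∀ i c v, AddCommMonoid (N i c v)]
    [∀ i c v, Module k (N i c v)] :
    (⨁ i, A i ⊗[k] (⨂[k] c : J i, ⨁ v : κ i c, N i c v)) ≃ₗ[k]
      ⨁ a : (Σ i, ∀ c : J i, κ i c), A a.1 ⊗[k] (⨂[k] c : J a.1, N a.1 c (a.2 c)) :=
  (DFinsupp.mapRange.linearEquiv fun i =>
    TensorProduct.congr (LinearEquiv.refl k (A i))
      (PiTensorProduct.ofDirectSumEquiv (R := k) (M := N i))) ≪≫ₗ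
  rightSum (k := k) A (κ := fun i => ∀ c : J i, κ i c) fun i v => ⨂[k] c : J i, N i c (v c)

theorem rightPiSum_lof {J : ι → Type} [∀ i, Finite (J i)] {κ : ∀ i, J i → Type}
    (N : ∀ i (c : J i), κ i c → Type u) [∀ i c v, AddCommMonoid (N i c v)]
    [∀ i c v, Module k (N i c v)] (i : ι) (v : ∀ c : J i, κ i c) (p : A i)
    (y : ∀ c, N i c (v c)) :
    rightPiSum (k := k) A N (DirectSum.lof k ι
      (fun i => A i ⊗[k] (⨂[k] c : J i, ⨁ v : κ i c, N i c v)) i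
      (p ⊗ₜ PiTensorProduct.tprod k fun c => DirectSum.lof k _ (N i c) (v c) (y c))) =
      DirectSum.lof k (Σ i, ∀ c : J i, κ i c)
        (fun a => A a.1 ⊗[k] (⨂[k] c : J a.1, N a.1 c (a.2 c))) ⟨i, v⟩
        (p ⊗ₜ PiTensorProduct.tprod k y) := by
  have h : PiTensorProduct.ofDirectSumEquiv (R := k) (M := N i)
      (PiTensorProduct.tprod k fun c => DirectSum.lof k _ (N i c) (v c) (y c)) =
      DirectSum.lof k (∀ c : J i, κ i c) (fun v => ⨂[k] c : J i, N i c (v c)) v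
        (PiTensorProduct.tprod k y) := by
    have := Fintype.ofFinite (J i)
    rw [PiTensorProduct.ofDirectSumEquiv_tprod_lof]
    congr!
  rw [rightPiSum, LinearEquiv.trans_apply, mapRange_lof, TensorProduct.congr_tmul, h]
  exact rightSum_lof (k := k) A (κ := fun i => ∀ c : J i, κ i c)
    (fun i v => ⨂[k] c : J i, N i c (v c)) i v _ p

end decomp

/- The associator -/

section assoc

variable (P Q R : SMod k)

/-- For `S → K → L`, the map between the fibres over a point of `L`. -/
def fibMap {S K L : Type} (f : S → K) (g : K → L) (l : L) : Fib (g ∘ f) l → Fib g l :=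
  fun s => ⟨f s.1, s.2⟩

theorem fibMap_surjective {S K L : Type} {f : S → K} (hf : Function.Surjective f) (g : K → L)
    (l : L) : Function.Surjective (fibMap f g l) := by
  rintro ⟨j, hj⟩
  obtain ⟨s, rfl⟩ := hf j
  exact ⟨⟨s, hj⟩, rfl⟩

/-- A fibre of `fibMap f g l` is a fibre of `f`. -/
def fibFib {S K L : Type} (f : S → K) (g : K → L) (l : L) (d : Fib g l) :
    Fib f d.1 ≃ Fib (fibMap f g l) d where
  toFun s := ⟨⟨s.1, by rw [Function.comp_apply, s.2]; exact d.2⟩, Subtype.ext s.2⟩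
  invFun x := ⟨x.1.1, congrArg Subtype.val x.2⟩
  left_inv _ := rfl
  right_inv _ := rfl

variable {S K L : Type} [Finite S] [Finite K] [Finite L]

/-- For `S → K → L`, distribute the decorations of the fibres of `f` over the points of `L`. -/
def regroup (f : S → K) (g : K → L) :
    (⨂[k] l : L, Q.obj (Fib g l)) ⊗[k] (⨂[k] j : K, R.obj (Fib f j)) →ₗ[k]
      ⨂[k] l : L, (Q.obj (Fib g l) ⊗[k] (⨂[k] d : Fib g l, R.obj (Fib (fibMap f g l) d))) :=
  zip _ _ ∘ₗ LinearMap.lTensor _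
    (PiTensorProduct.map (fun l => PiTensorProduct.map fun d => R.map (fibFib f g l d)) ∘ₗ
      group g fun j => R.obj (Fib f j))

/-- Two-level trees built from `p ∈ P(K)` and elements of `Q(f⁻¹(j))`, on tensors. -/
def mkT {S K : Type} [Finite S] [Finite K] (f : S → K) (hf : Function.Surjective f) :
    (P.obj K ⊗[k] (⨂[k] j : K, Q.obj (Fib f j))) →ₗ[k] compObj P Q S :=
  TensorProduct.lift (mkL P Q f hf)

/-- The associator on three-level trees with levels `S → K → L`. -/
def assocTree (f : S → K) (hf : Function.Surjective f) (g : K → L)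
    (hg : Function.Surjective g) :
    (P.obj L ⊗[k] (⨂[k] l : L, Q.obj (Fib g l))) ⊗[k] (⨂[k] j : K, R.obj (Fib f j)) →ₗ[k]
      compObj P (comp Q R) S :=
  mkT P (comp Q R) (g ∘ f) (hg.comp hf) ∘ₗ
    LinearMap.lTensor _
      (PiTensorProduct.map (fun l => mkT Q R (fibMap f g l) (fibMap_surjective hf g l)) ∘ₗ
        regroup Q R f g) ∘ₗ
    (TensorProduct.assoc k _ _ _).toLinearMap

/-- The map `((P ∘ Q) ∘ R)(S) → (P ∘ (Q ∘ R))(S)`. -/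
def assocHom (S : Type) [Finite S] : compObj (comp P Q) R S →ₗ[k] compObj P (comp Q R) S :=
  DirectSum.toModule k (Setoid S) _ fun r => TensorProduct.lift
    (DirectSum.toModule k (Setoid (Quotient r)) _ fun t => TensorProduct.curry
      (assocTree P Q R (Quotient.mk r) Quotient.mk_surjective
        (Quotient.mk t) Quotient.mk_surjective))

theorem assocTree_tprod (f : S → K) (hf : Function.Surjective f) (g : K → L)
    (hg : Function.Surjective g) (p : P.obj L) (q : ∀ l, Q.obj (Fib g l))
    (x : ∀ j, R.obj (Fib f j)) :
    assocTree P Q R f hf g hg ((p ⊗ₜ PiTensorProduct.tprod k q) ⊗ₜ PiTensorProduct.tprod k x) =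
      tree (g ∘ f) (hg.comp hf) p (fun l => (tree (fibMap f g l) (fibMap_surjective hf g l) (q l)
        fun d => R.map (fibFib f g l d) (x d.1) : compObj Q R (Fib (g ∘ f) l))) := by
  simp only [assocTree, regroup, mkT, zip, tree, LinearMap.comp_apply, LinearEquiv.coe_coe,
    TensorProduct.assoc_tmul, LinearMap.lTensor_tmul, group_tprod, PiTensorProduct.map_tprod,
    TensorProduct.lift.tmul, PiTensorProduct.map₂_tprod_tprod, TensorProduct.mk_apply]

/- The associator is bijective -/

/-- `regroup` as a linear equivalence. -/
def regroupE (f : S → K) (g : K → L) :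
    (⨂[k] l : L, Q.obj (Fib g l)) ⊗[k] (⨂[k] j : K, R.obj (Fib f j)) ≃ₗ[k]
      ⨂[k] l : L, (Q.obj (Fib g l) ⊗[k] (⨂[k] d : Fib g l, R.obj (Fib (fibMap f g l) d))) :=
  TensorProduct.congr (LinearEquiv.refl k _)
    (LinearEquiv.ofBijective _ (group_bijective g fun j => R.obj (Fib f j)) ≪≫ₗ
      PiTensorProduct.congr fun l => PiTensorProduct.congr fun d =>
        R.mapEquiv (fibFib f g l d)) ≪≫ₗ
    LinearEquiv.ofBijective _ (zip_bijective _ _)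

/-- A relabelling maps summands to summands. -/
def relabelSummand {T : Type} [Finite T] (e : S ≃ T) (r : Setoid S) :
    Summand P Q S r ≃ₗ[k] Summand P Q T (Setoid.ker (Quotient.mk r ∘ e.symm)) :=
  TensorProduct.congr (LinearEquiv.refl k _)
    (PiTensorProduct.congr fun b => Q.mapEquiv (fibEquiv e (fun s => by simp))) ≪≫ₗ
    toSummand P Q (Quotient.mk r ∘ e.symm) (Quotient.mk_surjective.comp e.symm.surjective)

theorem compMap_lof {T : Type} [Finite T] (e : S ≃ T) (r : Setoid S) (x : Summand P Q S r) :
    compMap P Q e (DirectSum.lof k (Setoid S) (Summand P Q S) r x) =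
      DirectSum.lof k (Setoid T) (Summand P Q T) _ (relabelSummand P Q e r x) := by
  rw [compMap, DirectSum.toModule_lof]
  refine LinearMap.congr_fun (g := DirectSum.lof k (Setoid T) (Summand P Q T) _ ∘ₗ
    (relabelSummand P Q e r).toLinearMap) (TensorProduct.ext (LinearMap.ext fun p =>
      PiTensorProduct.ext (MultilinearMap.ext fun q => ?_))) x
  simp [relabelSummand, mkL]

/-- A choice of a partition of `S` and of a partition of each of its classes. -/
abbrev Nested (S : Type) : Type :=
  Σ u : Setoid S, ∀ c : Quotient u, Setoid (Fib (Quotient.mk u) c)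

theorem Nested.ext {S : Type} {a b : Nested S} (h : a.1 = b.1)
    (h' : ∀ x y c hx hy c' hx' hy', (a.2 c).r ⟨x, hx⟩ ⟨y, hy⟩ ↔ (b.2 c').r ⟨x, hx'⟩ ⟨y, hy'⟩) :
    a = b := by
  obtain ⟨u, v⟩ := a
  obtain ⟨u', v'⟩ := b
  obtain rfl : u = u' := h
  congr 1
  funext c
  ext ⟨x, hx⟩ ⟨y, hy⟩
  exact h' x y c hx hy c hx hy

/-- A class of `ker f` is a fibre of `f`. -/
def kerFib {f : S → K} (hf : Function.Surjective f) (c : Quotient (Setoid.ker f)) :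
    Fib f (Setoid.quotientKerEquivOfSurjective f hf c) ≃ Fib (Quotient.mk (Setoid.ker f)) c :=
  fibEquiv (Equiv.refl S) (fun s => by
    rw [← (Setoid.quotientKerEquivOfSurjective f hf).injective.eq_iff]; rfl)

/-- The nested partition of `S` defined by surjections `S → K → L`. -/
abbrev nest {f : S → K} (hf : Function.Surjective f) {g : K → L} (hg : Function.Surjective g) :
    Nested S :=
  ⟨Setoid.ker (g ∘ f), fun c => Setoid.ker
    (Quotient.mk (Setoid.ker (fibMap f g
      (Setoid.quotientKerEquivOfSurjective (g ∘ f) (hg.comp hf) c))) ∘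
        (kerFib (hg.comp hf) c).symm)⟩

theorem nest_rel {f : S → K} (hf : Function.Surjective f) {g : K → L}
    (hg : Function.Surjective g) (c) (x y : S) (hx hy) :
    ((nest hf hg).2 c).r ⟨x, hx⟩ ⟨y, hy⟩ ↔ f x = f y := by
  refine Iff.trans (Quotient.eq (r := Setoid.ker (fibMap f g
      (Setoid.quotientKerEquivOfSurjective (g ∘ f) (hg.comp hf) c)))) ?_
  exact Subtype.ext_iff

theorem nest_bijective (S : Type) [Finite S] : Function.Bijective
    (fun a : Σ r : Setoid S, Setoid (Quotient r) =>
      nest (f := Quotient.mk a.1) Quotient.mk_surjective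
        (g := Quotient.mk a.2) Quotient.mk_surjective) := by
  constructor
  · rintro ⟨r, t⟩ ⟨r', t'⟩ h
    have h1 : Setoid.ker (Quotient.mk t ∘ Quotient.mk r) =
      Setoid.ker (Quotient.mk t' ∘ Quotient.mk r') := congrArg Sigma.fst h
    have aux : ∀ (a b : Nested S), a = b → ∀ x y, (∃ c hx hy, (a.2 c).r ⟨x, hx⟩ ⟨y, hy⟩) →
        ∃ c hx hy, (b.2 c).r ⟨x, hx⟩ ⟨y, hy⟩ := by
      rintro a b rfl x y h; exact h
    have key : ∀ (r r' : Setoid S) (t : Setoid (Quotient r)) (t' : Setoid (Quotient r')),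
        nest (f := Quotient.mk r) Quotient.mk_surjective
          (g := Quotient.mk t) Quotient.mk_surjective =
        nest (f := Quotient.mk r') Quotient.mk_surjective
          (g := Quotient.mk t') Quotient.mk_surjective → ∀ x y, r x y → r' x y := by
      intro r r' t t' h x y hxy
      have h0 : Quotient.mk r x = Quotient.mk r y := Quotient.sound hxy
      obtain ⟨c, hx, hy, h2⟩ := aux _ _ h x y
        ⟨Quotient.mk _ y, Quotient.sound (by
          change (Quotient.mk t ∘ Quotient.mk r) x = (Quotient.mk t ∘ Quotient.mk r) y
          rw [Function.comp_apply, Function.comp_apply, h0]), rfl, (nest_rel _ _ _ _ _ _ _).2 h0⟩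
      exact Quotient.exact ((nest_rel _ _ _ _ _ _ _).1 h2)
    obtain rfl : r = r' := Setoid.ext fun x y => ⟨key _ _ _ _ h x y, key _ _ _ _ h.symm x y⟩
    congr 1
    ext a b
    induction a using Quotient.inductionOn with | h x => ?_
    induction b using Quotient.inductionOn with | h y => ?_
    have h3 : (Quotient.mk t (Quotient.mk r x) = Quotient.mk t (Quotient.mk r y)) ↔
        (Quotient.mk t' (Quotient.mk r x) = Quotient.mk t' (Quotient.mk r y)) := by
      have := congrArg (fun s : Setoid S => s.r x y) h1
      exact iff_of_eq this
    rw [Quotient.eq, Quotient.eq] at h3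
    exact h3
  · intro a
    let r : Setoid S :=
      { r := fun x y => ∃ c hx hy, (a.2 c).r ⟨x, hx⟩ ⟨y, hy⟩
        iseqv := by
          refine ⟨fun x => ⟨_, rfl, rfl, (a.2 _).refl _⟩, ?_, ?_⟩
          · rintro x y ⟨c, hx, hy, h⟩
            exact ⟨c, hy, hx, (a.2 c).symm h⟩
          · rintro x y z ⟨c, hx, hy, h⟩ ⟨c', hy', hz, h'⟩
            obtain rfl : c = c' := hy.symm.trans hy'
            exact ⟨c, hx, hz, (a.2 c).trans h h'⟩ }
    let q : Quotient r → Quotient a.1 := Quotient.lift (Quotient.mk a.1) (by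
      rintro x y ⟨c, hx, hy, -⟩
      exact hx.trans hy.symm)
    refine ⟨⟨r, Setoid.ker q⟩, Nested.ext ?_ ?_⟩
    · ext x y
      refine Iff.trans (Quotient.eq (r := Setoid.ker q)) ?_
      exact Quotient.eq (r := a.1)
    · intro x y c hx hy c' hx' hy'
      rw [nest_rel, Quotient.eq]
      constructor
      · rintro ⟨c'', hx'', hy'', h⟩
        obtain rfl : c'' = c' := hx''.symm.trans hx'
        exact h
      · exact fun h => ⟨c', hx', hy', h⟩

/-- The summand of `P ∘ (Q ∘ R)` for a nested partition. -/
abbrev NestedSummand (S : Type) [Finite S] (a : Nested S) : Type u :=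
  P.obj (Quotient a.1) ⊗[k] (⨂[k] c : Quotient a.1, Summand Q R (Fib (Quotient.mk a.1) c) (a.2 c))

/-- `P ∘ (Q ∘ R)` as a direct sum over nested partitions. -/
def rightDecomp (S : Type) [Finite S] :
    compObj P (comp Q R) S ≃ₗ[k] ⨁ a : Nested S, NestedSummand P Q R S a :=
  rightPiSum (fun u : Setoid S => P.obj (Quotient u))
    (fun u (c : Quotient u) v => Summand Q R (Fib (Quotient.mk u) c) v)

/-- `(P ∘ Q) ∘ R` as a direct sum over partitions of partitions. -/
def leftDecomp (S : Type) [Finite S] :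
    compObj (comp P Q) R S ≃ₗ[k] ⨁ a : (Σ r : Setoid S, Setoid (Quotient r)),
      (Summand P Q (Quotient a.1) a.2 ⊗[k]
        (⨂[k] b : Quotient a.1, R.obj (Fib (Quotient.mk a.1) b))) :=
  leftSum (fun r : Setoid S => ⨂[k] b : Quotient r, R.obj (Fib (Quotient.mk r) b))
    (fun r t => Summand P Q (Quotient r) t)

/-- The associator on a single summand. -/
def assocSummand {f : S → K} (hf : Function.Surjective f) {g : K → L}
    (hg : Function.Surjective g) :
    (P.obj L ⊗[k] (⨂[k] l : L, Q.obj (Fib g l))) ⊗[k] (⨂[k] j : K, R.obj (Fib f j)) ≃ₗ[k]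
      NestedSummand P Q R S (nest hf hg) :=
  TensorProduct.assoc k _ _ _ ≪≫ₗ
    TensorProduct.congr (P.mapEquiv (Setoid.quotientKerEquivOfSurjective _ (hg.comp hf)).symm)
      (regroupE Q R f g ≪≫ₗ
        PiTensorProduct.congr (fun l => toSummand Q R (fibMap f g l) (fibMap_surjective hf g l)) ≪≫ₗ
        PiTensorProduct.reindex k
          (fun l => Summand Q R (Fib (g ∘ f) l) (Setoid.ker (fibMap f g l)))
          (Setoid.quotientKerEquivOfSurjective _ (hg.comp hf)).symm ≪≫ₗ
        PiTensorProduct.congr fun c => relabelSummand Q R (kerFib (hg.comp hf) c)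
          (Setoid.ker (fibMap f g (Setoid.quotientKerEquivOfSurjective _ (hg.comp hf) c))))

theorem rightDecomp_lof (u : Setoid S) (v : ∀ c : Quotient u, Setoid (Fib (Quotient.mk u) c))
    (p : P.obj (Quotient u)) (y : ∀ c, Summand Q R (Fib (Quotient.mk u) c) (v c)) :
    rightDecomp P Q R S (DirectSum.lof k (Setoid S) (Summand P (comp Q R) S) u
      (p ⊗ₜ PiTensorProduct.tprod k fun c =>
        (DirectSum.lof k _ (Summand Q R (Fib (Quotient.mk u) c)) (v c) (y c) :
          compObj Q R (Fib (Quotient.mk u) c)))) =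
      DirectSum.lof k (Nested S) (NestedSummand P Q R S) ⟨u, v⟩
        (p ⊗ₜ PiTensorProduct.tprod k y) :=
  rightPiSum_lof (fun u : Setoid S => P.obj (Quotient u))
    (fun u (c : Quotient u) v => Summand Q R (Fib (Quotient.mk u) c) v) u v p y

theorem leftDecomp_symm_lof (r : Setoid S) (t : Setoid (Quotient r))
    (x : Summand P Q (Quotient r) t) (y : ⨂[k] b : Quotient r, R.obj (Fib (Quotient.mk r) b)) :
    (leftDecomp P Q R S).symm (DirectSum.lof k _ _ ⟨r, t⟩ (x ⊗ₜ y)) =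
      DirectSum.lof k (Setoid S) (Summand (comp P Q) R S) r
        (DirectSum.lof k _ (Summand P Q (Quotient r)) t x ⊗ₜ y) := by
  rw [LinearEquiv.symm_apply_eq]
  exact (leftSum_lof (fun r : Setoid S => ⨂[k] b : Quotient r, R.obj (Fib (Quotient.mk r) b))
    (fun r t => Summand P Q (Quotient r) t) r t x y).symm

theorem tree_eq_lof_toSummand {f : S → K} (hf : Function.Surjective f) (p : P.obj K)
    (q : ∀ j : K, Q.obj (Fib f j)) :
    tree f hf p q = DirectSum.lof k (Setoid S) (Summand P Q S) (Setoid.ker f)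
      (toSummand P Q f hf (p ⊗ₜ PiTensorProduct.tprod k q)) := rfl

theorem regroupE_tprod (f : S → K) (g : K → L) (q : ∀ l, Q.obj (Fib g l))
    (x : ∀ j, R.obj (Fib f j)) :
    regroupE Q R f g (PiTensorProduct.tprod k q ⊗ₜ PiTensorProduct.tprod k x) =
      PiTensorProduct.tprod k fun l => q l ⊗ₜ
        PiTensorProduct.tprod k fun d => R.map (fibFib f g l d) (x d.1) := by
  rw [regroupE, LinearEquiv.trans_apply, TensorProduct.congr_tmul, LinearEquiv.trans_apply,
    LinearEquiv.ofBijective_apply, LinearEquiv.ofBijective_apply, group_tprod,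
    PiTensorProduct.congr_tprod, zip, TensorProduct.lift.tmul]
  simp only [PiTensorProduct.congr_tprod]
  exact PiTensorProduct.map₂_tprod_tprod _ _ _

theorem assocSummand_tprod {f : S → K} (hf : Function.Surjective f) {g : K → L}
    (hg : Function.Surjective g) (p : P.obj L) (q : ∀ l, Q.obj (Fib g l))
    (x : ∀ j, R.obj (Fib f j)) :
    assocSummand P Q R hf hg
        ((p ⊗ₜ PiTensorProduct.tprod k q) ⊗ₜ PiTensorProduct.tprod k x) =
      P.map (Setoid.quotientKerEquivOfSurjective _ (hg.comp hf)).symm p ⊗ₜ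
        PiTensorProduct.tprod k fun c => relabelSummand Q R (kerFib (hg.comp hf) c)
          (Setoid.ker (fibMap f g (Setoid.quotientKerEquivOfSurjective _ (hg.comp hf) c)))
          (toSummand Q R _ (fibMap_surjective hf g _)
            (q (Setoid.quotientKerEquivOfSurjective _ (hg.comp hf) c) ⊗ₜ
              PiTensorProduct.tprod k fun d => R.map (fibFib f g _ d) (x d.1))) := by
  refine congrArg (fun z => P.map _ p ⊗ₜ[k] z) ?_
  change PiTensorProduct.congr _ (PiTensorProduct.reindex k _ _ (PiTensorProduct.congr _
    (regroupE Q R f g (PiTensorProduct.tprod k q ⊗ₜ PiTensorProduct.tprod k x)))) = _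
  rw [regroupE_tprod, PiTensorProduct.congr_tprod, PiTensorProduct.reindex_tprod,
    PiTensorProduct.congr_tprod]
  rfl

theorem rightDecomp_assocTree {f : S → K} (hf : Function.Surjective f) {g : K → L}
    (hg : Function.Surjective g) (x) :
    rightDecomp P Q R S (assocTree P Q R f hf g hg x) =
      DirectSum.lof k (Nested S) (NestedSummand P Q R S) (nest hf hg)
        (assocSummand P Q R hf hg x) := by
  refine LinearMap.congr_fun (f := (rightDecomp P Q R S).toLinearMap ∘ₗ assocTree P Q R f hf g hg)
    (g := DirectSum.lof k (Nested S) (NestedSummand P Q R S) (nest hf hg) ∘ₗ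
      (assocSummand P Q R hf hg).toLinearMap) ?_ x
  refine tensor_ext fun p q x => ?_
  rw [LinearMap.comp_apply, LinearMap.comp_apply, LinearEquiv.coe_coe, LinearEquiv.coe_coe]
  rw [assocTree_tprod, tree_eq_lof, assocSummand_tprod]
  refine Eq.trans (congrArg _ (congrArg _ (congrArg _ (congrArg _ (funext fun c =>
    compMap_lof Q R (kerFib (hg.comp hf) c) _ _))))) ?_
  exact rightDecomp_lof P Q R _ _ _ _

theorem assocHom_lof (S : Type) [Finite S] (a : Σ r : Setoid S, Setoid (Quotient r))
    (x : Summand P Q (Quotient a.1) a.2 ⊗[k]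
        (⨂[k] b : Quotient a.1, R.obj (Fib (Quotient.mk a.1) b))) :
    assocHom P Q R S ((leftDecomp P Q R S).symm (DirectSum.lof k _ _ a x)) =
      assocTree P Q R (Quotient.mk a.1) Quotient.mk_surjective
        (Quotient.mk a.2) Quotient.mk_surjective x := by
  induction x using TensorProduct.induction_on with
  | zero => simp only [map_zero]
  | add x y hx hy => simp only [map_add, hx, hy]
  | tmul x y =>
    rw [leftDecomp_symm_lof, assocHom, DirectSum.toModule_lof,
      TensorProduct.lift.tmul, DirectSum.toModule_lof, TensorProduct.curry_apply]

theorem assocHom_bijective (S : Type) [Finite S] : Function.Bijective (assocHom P Q R S) :=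
  decomp_bijective (assocHom P Q R S) (leftDecomp P Q R S) (rightDecomp P Q R S)
    (Equiv.ofBijective _ (nest_bijective S))
    (fun a => assocSummand P Q R (f := Quotient.mk a.1) Quotient.mk_surjective
      (g := Quotient.mk a.2) Quotient.mk_surjective) fun a x =>
    (congrArg (rightDecomp P Q R S) (assocHom_lof P Q R S a x)).trans
      (rightDecomp_assocTree P Q R _ _ x)

/-- The associativity isomorphism `(P ∘ Q) ∘ R ≅ P ∘ (Q ∘ R)` of the composite product. -/
def assoc (S : Type) [Finite S] :
    (comp (comp P Q) R).obj S ≃ₗ[k] (comp P (comp Q R)).obj S :=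
  LinearEquiv.ofBijective (assocHom P Q R S) (assocHom_bijective P Q R S)

end assoc

/- Maps between `𝕊`-modules, unit and unitors -/

/-- A family of linear maps `P(S) → Q(S)`, one for every finite set `S`. -/
abbrev Fam (P Q : SMod k) : Type (max 1 u) :=
  ∀ (S : Type) [Finite S], P.obj S →ₗ[k] Q.obj S

/-- Compatibility with relabellings: the morphisms of `𝕊`-modules are the natural families. -/
def IsNatural {P Q : SMod k} (φ : Fam P Q) : Prop :=
  ∀ {S T : Type} [Finite S] [Finite T] (e : S ≃ T) (x : P.obj S),
    φ T (P.map e x) = Q.map e (φ S x)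

/-- The identity family. -/
def idFam (P : SMod k) : Fam P P := fun _ _ => LinearMap.id

/-- The composite product `φ ∘ ψ : P ∘ Q → P' ∘ Q'` of families of linear maps. -/
def hcomp {P P' Q Q' : SMod k} (φ : Fam P P') (ψ : Fam Q Q') : Fam (comp P Q) (comp P' Q') :=
  fun S _ => (DirectSum.lmap fun r : Setoid S => TensorProduct.map (φ (Quotient r))
    (PiTensorProduct.map fun b => ψ (Fib (Quotient.mk r) b)) :
      compObj P Q S →ₗ[k] compObj P' Q' S)

/-- The unit `𝕊`-module: `k` on one-element sets and zero otherwise. -/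
def unit (k : Type u) [Field k] : SMod k where
  obj S _ := {s : S // ∀ t, t = s} →₀ k
  map e := Finsupp.lmapDomain k k (e.subtypeEquiv fun s => by
    constructor
    · intro h t
      rw [← h (e.symm t), e.apply_symm_apply]
    · intro h t
      exact e.injective (h (e t)))
  map_refl S _ x := by
    rw [Finsupp.lmapDomain_apply]
    exact Finsupp.mapDomain_id
  map_trans e e' x := by
    simp only [Finsupp.lmapDomain_apply, ← Finsupp.mapDomain_comp]
    rfl
  reduced S _ _ := inferInstance

/-- The inverse left unitor `P → I ∘ P`. -/
def leftUnit (P : SMod k) : Fam P (comp (unit k) P) := fun S _ =>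
  if h : Nonempty S then
    mkL (unit k) P (fun _ : S => ()) (fun _ => h.elim fun s => ⟨s, rfl⟩)
      (Finsupp.single ⟨(), fun _ => rfl⟩ 1) ∘ₗ
    (PiTensorProduct.subsingletonEquiv (R := k)
      (s := fun j : Unit => P.obj (Fib (fun _ : S => ()) j)) ()).symm.toLinearMap ∘ₗ
    P.map (Equiv.subtypeUnivEquiv fun _ => rfl).symm
  else 0

/-- The inverse right unitor `P → P ∘ I`. -/
def rightUnit (P : SMod k) : Fam P (comp P (unit k)) := fun S _ =>
  (mkL P (unit k) (id : S → S) Function.surjective_id).flip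
    (PiTensorProduct.tprod k fun s => Finsupp.single ⟨⟨s, rfl⟩, fun t => Subtype.ext t.2⟩ 1)

end SMod

open SMod

/- Operads and distributive laws -/

/-- The data of an operad: an `𝕊`-module `P` with maps `P ∘ P → P` and `I → P`. -/
structure OperadData (k : Type u) [Field k] where
  toSMod : SMod k
  mul : Fam (comp toSMod toSMod) toSMod
  one : Fam (unit k) toSMod

/-- An operad is a monoid in the monoidal category of `𝕊`-modules with the composite product. -/
structure IsOperad (P : OperadData k) : Prop where
  mul_natural : IsNatural P.mul
  one_natural : IsNatural P.one
  mul_assoc : ∀ (S : Type) [Finite S] (x : (comp (comp P.toSMod P.toSMod) P.toSMod).obj S),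
    P.mul S (hcomp P.mul (idFam P.toSMod) S x) =
      P.mul S (hcomp (idFam P.toSMod) P.mul S (assoc P.toSMod P.toSMod P.toSMod S x))
  one_mul : ∀ (S : Type) [Finite S] (x : P.toSMod.obj S),
    P.mul S (hcomp P.one (idFam P.toSMod) S (leftUnit P.toSMod S x)) = x
  mul_one : ∀ (S : Type) [Finite S] (x : P.toSMod.obj S),
    P.mul S (hcomp (idFam P.toSMod) P.one S (rightUnit P.toSMod S x)) = x

/-- Morphisms of operads. -/
structure IsOperadHom (P Q : OperadData k) (φ : Fam P.toSMod Q.toSMod) : Prop where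
  natural : IsNatural φ
  map_mul : ∀ (S : Type) [Finite S] (x : (comp P.toSMod P.toSMod).obj S),
    φ S (P.mul S x) = Q.mul S (hcomp φ φ S x)
  map_one : ∀ (S : Type) [Finite S] (x : (unit k).obj S), φ S (P.one S x) = Q.one S x

/-- Isomorphisms of operads. -/
structure IsOperadIso (P Q : OperadData k) (φ : Fam P.toSMod Q.toSMod) : Prop
    extends IsOperadHom P Q φ where
  bijective : ∀ (S : Type) [Finite S], Function.Bijective (φ S)

/-- The map `(S ∖ {a}) ⊔ T → S` that sends all of `T` to `a`. -/
def insertMap {S : Type} (a : S) (T : Type) : {s : S // s ≠ a} ⊕ T → S :=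
  Sum.elim Subtype.val fun _ => a

theorem insertMap_surjective {S : Type} (a : S) (T : Type) [Nonempty T] :
    Function.Surjective (insertMap a T) := fun s => by
  by_cases h : s = a
  · exact ⟨Sum.inr (Classical.arbitrary T), h.symm⟩
  · exact ⟨Sum.inl ⟨s, h⟩, rfl⟩

/-- The identification of `T` with the fibre of `insertMap` over `a`. -/
def insertFib {S : Type} (a : S) (T : Type) : T ≃ Fib (insertMap a T) a where
  toFun t := ⟨Sum.inr t, rfl⟩
  invFun x := match x with
    | ⟨Sum.inl s, h⟩ => (s.2 h).elim
    | ⟨Sum.inr t, _⟩ => t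
  left_inv _ := rfl
  right_inv x := match x with
    | ⟨Sum.inl s, h⟩ => (s.2 h).elim
    | ⟨Sum.inr _, _⟩ => rfl

/-- The partial composition `p ∘ₐ q`: the composition of `p` with `q` at the input `a` and with the
operadic unit at all the other inputs. -/
def OperadData.circ (P : OperadData k) {S T : Type} [Finite S] [Finite T] [Nonempty T] (a : S)
    (p : P.toSMod.obj S) (q : P.toSMod.obj T) : P.toSMod.obj ({s : S // s ≠ a} ⊕ T) :=
  P.mul _ (tree (insertMap a T) (insertMap_surjective a T) p fun s =>
    if h : s = a then
      P.toSMod.map ((insertFib a T).trans (fibEquiv (Equiv.refl _) fun x => by rw [h]; rfl)) q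
    else P.one _ (Finsupp.single ⟨⟨Sum.inl ⟨s, h⟩, rfl⟩, fun x => match x with
      | ⟨Sum.inl _, hx⟩ => Subtype.ext (congrArg Sum.inl (Subtype.ext hx))
      | ⟨Sum.inr _, hx⟩ => (h hx.symm).elim⟩ 1))

/-- Distributive laws `Λ : Q ∘ P → P ∘ Q` between operads `P` and `Q`. -/
structure IsDistributiveLaw (P Q : OperadData k)
    (Λ : Fam (comp Q.toSMod P.toSMod) (comp P.toSMod Q.toSMod)) : Prop where
  natural : IsNatural Λ
  /-- `Λ (id ∘ γ_P) = (γ_P ∘ id) (id ∘ Λ) (Λ ∘ id)` on `Q ∘ P ∘ P` -/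
  law_I : ∀ (S : Type) [Finite S] (x : (comp (comp Q.toSMod P.toSMod) P.toSMod).obj S),
    Λ S (hcomp (idFam Q.toSMod) P.mul S (assoc Q.toSMod P.toSMod P.toSMod S x)) =
      hcomp P.mul (idFam Q.toSMod) S ((assoc P.toSMod P.toSMod Q.toSMod S).symm
        (hcomp (idFam P.toSMod) Λ S (assoc P.toSMod Q.toSMod P.toSMod S
          (hcomp Λ (idFam P.toSMod) S x))))
  /-- `Λ (γ_Q ∘ id) = (id ∘ γ_Q) (Λ ∘ id) (id ∘ Λ)` on `Q ∘ Q ∘ P` -/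
  law_II : ∀ (S : Type) [Finite S] (x : (comp (comp Q.toSMod Q.toSMod) P.toSMod).obj S),
    Λ S (hcomp Q.mul (idFam P.toSMod) S x) =
      hcomp (idFam P.toSMod) Q.mul S (assoc P.toSMod Q.toSMod Q.toSMod S
        (hcomp Λ (idFam Q.toSMod) S ((assoc Q.toSMod P.toSMod Q.toSMod S).symm
          (hcomp (idFam Q.toSMod) Λ S (assoc Q.toSMod Q.toSMod P.toSMod S x)))))
  /-- `Λ (η_Q ∘ id) = id ∘ η_Q` on `P` -/
  law_i : ∀ (S : Type) [Finite S] (x : P.toSMod.obj S),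
    Λ S (hcomp Q.one (idFam P.toSMod) S (leftUnit P.toSMod S x)) =
      hcomp (idFam P.toSMod) Q.one S (rightUnit P.toSMod S x)
  /-- `Λ (id ∘ η_P) = η_P ∘ id` on `Q` -/
  law_ii : ∀ (S : Type) [Finite S] (x : Q.toSMod.obj S),
    Λ S (hcomp (idFam Q.toSMod) P.one S (rightUnit Q.toSMod S x)) =
      hcomp P.one (idFam Q.toSMod) S (leftUnit Q.toSMod S x)

/-- The composite operad `P ∘ Q` of a distributive law `Λ`, with composition map
`(γ_P ∘ γ_Q) (id ∘ Λ ∘ id) : P ∘ Q ∘ P ∘ Q → P ∘ Q` and unit `η_P ∘ η_Q`. -/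
def compositeOperad (P Q : OperadData k)
    (Λ : Fam (comp Q.toSMod P.toSMod) (comp P.toSMod Q.toSMod)) : OperadData k where
  toSMod := comp P.toSMod Q.toSMod
  mul S _ :=
    hcomp P.mul Q.mul S ∘ₗ
    (assoc P.toSMod P.toSMod (comp Q.toSMod Q.toSMod) S).symm.toLinearMap ∘ₗ
    hcomp (idFam P.toSMod) (fun T _ => (assoc P.toSMod Q.toSMod Q.toSMod T).toLinearMap) S ∘ₗ
    hcomp (idFam P.toSMod) (hcomp Λ (idFam Q.toSMod)) S ∘ₗ
    hcomp (idFam P.toSMod) (fun T _ => (assoc Q.toSMod P.toSMod Q.toSMod T).symm.toLinearMap) S ∘ₗ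
    (assoc P.toSMod Q.toSMod (comp P.toSMod Q.toSMod) S).toLinearMap
  one S _ := hcomp P.one Q.one S ∘ₗ rightUnit (unit k) S

/- Linearisation of set-valued `𝕊`-modules -/

/-- A reduced set-valued `𝕊`-module, as a functor from finite sets and bijections to sets. -/
structure SetSMod where
  obj : (S : Type) → [Finite S] → Type
  map : ∀ {S T : Type} [Finite S] [Finite T], (S ≃ T) → obj S → obj T
  map_refl : ∀ (S : Type) [Finite S] (x : obj S), map (Equiv.refl S) x = x
  map_trans : ∀ {S T U : Type} [Finite S] [Finite T] [Finite U] (e : S ≃ T) (e' : T ≃ U)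
    (x : obj S), map (e.trans e') x = map e' (map e x)
  reduced : ∀ (S : Type) [Finite S] [IsEmpty S], IsEmpty (obj S)

/-- The `k`-linear `𝕊`-module spanned by a set-valued one. -/
abbrev SetSMod.lin (k : Type u) [Field k] (X : SetSMod) : SMod k where
  obj S _ := X.obj S →₀ k
  map e := Finsupp.lmapDomain k k (X.map e)
  map_refl S _ x := by
    rw [Finsupp.lmapDomain_apply, show X.map (Equiv.refl S) = id from funext (X.map_refl S)]
    exact Finsupp.mapDomain_id
  map_trans e e' x := by
    simp only [Finsupp.lmapDomain_apply, ← Finsupp.mapDomain_comp]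
    congr 1
    exact funext (X.map_trans e e')
  reduced S _ _ := by
    have := X.reduced S
    infer_instance

/-- The multilinear extension of an operation on basis elements. -/
def SetSMod.linMul (k : Type u) [Field k] (X : SetSMod)
    (F : ∀ (S : Type) [Finite S] (r : Setoid S), X.obj (Quotient r) →
      (∀ b, X.obj (Fib (Quotient.mk r) b)) → (X.obj S →₀ k)) :
    Fam (comp (X.lin k) (X.lin k)) (X.lin k) := fun S _ =>
  DirectSum.toModule k (Setoid S) _ fun r =>
    haveI := Fintype.ofFinite (Quotient r)
    Finsupp.linearCombination k (fun a : X.obj (Quotient r) ×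
        (∀ b, X.obj (Fib (Quotient.mk r) b)) => F S r a.1 a.2) ∘ₗ
      (finsuppTensorFinsupp' k _ _).toLinearMap ∘ₗ
      LinearMap.lTensor _ (PiTensorProduct.ofFinsuppEquiv' (R := k)
        (κ := fun b => X.obj (Fib (Quotient.mk r) b))).toLinearMap

theorem SetSMod.linMul_tree (X : SetSMod)
    (F : ∀ (S : Type) [Finite S] (r : Setoid S), X.obj (Quotient r) →
      (∀ b, X.obj (Fib (Quotient.mk r) b)) → (X.obj S →₀ k)) (S : Type) [Finite S] (r : Setoid S)
    (x : X.obj (Quotient r)) (y : ∀ b, X.obj (Fib (Quotient.mk r) b)) :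
    X.linMul k F S (tree (P := X.lin k) (Q := X.lin k) (Quotient.mk r) Quotient.mk_surjective
      (Finsupp.single x 1) fun b => Finsupp.single (y b) 1) = F S r x y := by
  let := Fintype.ofFinite (Quotient r)
  refine (congrArg _ (tree_mk (P := X.lin k) (Q := X.lin k) r _ _)).trans ?_
  rw [linMul]
  refine (DirectSum.toModule_lof k r _).trans ?_
  rw [LinearMap.comp_apply, LinearMap.comp_apply]
  refine (congrArg _ (congrArg (finsuppTensorFinsupp' k _ _)
    (congrArg (fun z => Finsupp.single x 1 ⊗ₜ[k] z)
      (PiTensorProduct.ofFinsuppEquiv'_tprod_single _ _)))).trans ?_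
  simp

/- The operad of commutative algebras -/

/-- The set-valued `𝕊`-module with one element on every non-empty set. -/
def comSet : SetSMod where
  obj S _ := PLift (Nonempty S)
  map e x := ⟨x.down.map e⟩
  map_refl _ _ _ := rfl
  map_trans _ _ _ := rfl
  reduced S _ _ := ⟨fun x => not_isEmpty_iff.2 x.down ‹_›⟩

/-- The operad `Com`: one-dimensional with trivial action in every positive arity, and any
composite of generators is the generator. -/
def Com (k : Type u) [Field k] : OperadData k where
  toSMod := comSet.lin k
  mul := comSet.linMul k fun _ _ _ x _ => Finsupp.single ⟨x.down.map Quotient.out⟩ 1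
  one _ _ := Finsupp.lmapDomain k k fun s => ⟨⟨s.1⟩⟩

/- The operads of directed simple graphs -/

/-- Directed simple graphs, not necessarily connected, with at least one vertex and set of vertices
`S`: directed by a global flow means that there are no directed cycles, so that in particular there
are no loops and there is at most one edge between two vertices. -/
@[ext]
structure DGraph (S : Type) where
  Adj : S → S → Prop
  acyclic : ∀ x, ¬ Relation.TransGen Adj x x
  nonempty : Nonempty S

namespace DGraph

/-- Relabelling the vertices. -/
def map {S T : Type} (e : S ≃ T) (g : DGraph S) : DGraph T where
  Adj x y := g.Adj (e.symm x) (e.symm y)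
  acyclic x h := g.acyclic (e.symm x) (Relation.TransGen.lift (p := g.Adj) e.symm
    (fun _ _ h => h) x x h)
  nonempty := g.nonempty.map e

/-- The graph without edges. -/
def edgeless (S : Type) (h : Nonempty S) : DGraph S where
  Adj _ _ := False
  acyclic x h := by
    obtain ⟨y, -, h⟩ := Relation.TransGen.tail'_iff.1 h
    exact h
  nonempty := h

/-- Connected graphs. -/
def Connected {S : Type} (g : DGraph S) : Prop := (SimpleGraph.fromRel g.Adj).Connected

theorem Connected.map {S T : Type} {g : DGraph S} (h : g.Connected) (e : S ≃ T) :
    (g.map e).Connected := by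
  refine SimpleGraph.Iso.connected_iff (⟨e, ?_⟩ : SimpleGraph.fromRel g.Adj ≃g
    SimpleGraph.fromRel (g.map e).Adj) |>.1 h
  intro a b
  simp [SimpleGraph.fromRel_adj, DGraph.map]

instance {S : Type} [Finite S] : Finite (DGraph S) :=
  Finite.of_injective DGraph.Adj fun _ _ h => DGraph.ext h

/-- `G` is obtained from the graph `g` on the set of classes of `r` by inserting a graph `h b` at
every vertex `b`, and by replacing every edge `b → b'` of `g` by at least one edge from a vertex of
`h b` to a vertex of `h b'`. -/
def IsComposite {S : Type} (r : Setoid S) (g : DGraph (Quotient r))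
    (h : ∀ b, DGraph (Fib (Quotient.mk r) b)) (G : DGraph S) : Prop :=
  (∀ b x y, (h b).Adj x y ↔ G.Adj x.1 y.1) ∧
    ∀ b b', b ≠ b' → (g.Adj b b' ↔ ∃ x y, Quotient.mk r x = b ∧ Quotient.mk r y = b' ∧ G.Adj x y)

/-- `G` is a summand of the partial composition `g ∘ₐ h`: its set of vertices is obtained by
inserting `h` at the vertex `a` of `g`, and every vertex of `g` joined to `a` is joined in the same
direction to at least one vertex of `h`. -/
def IsInsertion {S T : Type} (a : S) (g : DGraph S) (h : DGraph T)
    (G : DGraph ({s : S // s ≠ a} ⊕ T)) : Prop :=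
  (∀ s s' : {s : S // s ≠ a}, G.Adj (Sum.inl s) (Sum.inl s') ↔ g.Adj s s') ∧
  (∀ t t' : T, G.Adj (Sum.inr t) (Sum.inr t') ↔ h.Adj t t') ∧
  (∀ s : {s : S // s ≠ a}, (∃ t, G.Adj (Sum.inl s) (Sum.inr t)) ↔ g.Adj s a) ∧
  (∀ s : {s : S // s ≠ a}, (∃ t, G.Adj (Sum.inr t) (Sum.inl s)) ↔ g.Adj a s)

end DGraph

/-- The set-valued `𝕊`-module of not necessarily connected directed simple graphs. -/
def ncGraSet : SetSMod where
  obj S _ := DGraph S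
  map e g := g.map e
  map_refl _ _ _ := rfl
  map_trans _ _ _ := rfl
  reduced S _ _ := ⟨fun g => not_isEmpty_iff.2 g.nonempty ‹_›⟩

/-- The set-valued `𝕊`-module of connected directed simple graphs. -/
def graSet : SetSMod where
  obj S _ := {g : DGraph S // g.Connected}
  map e g := ⟨g.1.map e, g.2.map e⟩
  map_refl _ _ _ := rfl
  map_trans _ _ _ := rfl
  reduced S _ _ := ⟨fun g => not_isEmpty_iff.2 g.1.nonempty ‹_›⟩

/-- The sum of the elements of a finite set, in the vector space spanned by it. -/
def sumOf (k : Type u) [Field k] {X : Type} [Finite X] (p : X → Prop) : X →₀ k :=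
  Finsupp.equivFunOnFinite.symm fun G => if p G then 1 else 0

/-- `Lie-ncgra`: the span of the directed simple graphs that are not necessarily connected; the
composite of a graph with graphs inserted at its vertices is the sum of all the ways of replacing
the edges by at least one edge each. -/
def LieNcGra (k : Type u) [Field k] : OperadData k where
  toSMod := ncGraSet.lin k
  mul := ncGraSet.linMul k fun S _ r g h =>
    sumOf k (X := DGraph S) fun G => DGraph.IsComposite r g h G
  one S _ := Finsupp.lmapDomain k k fun s => DGraph.edgeless S ⟨s.1⟩

/-- A connected graph with the one-vertex set of vertices. -/
theorem edgeless_connected {S : Type} (s : {s : S // ∀ t, t = s}) :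
    (DGraph.edgeless S ⟨s.1⟩).Connected := by
  have : Subsingleton S := ⟨fun a b => (s.2 a).trans (s.2 b).symm⟩
  have : Nonempty S := ⟨s.1⟩
  exact (SimpleGraph.connected_iff _).2 ⟨SimpleGraph.Preconnected.of_subsingleton, this⟩

/-- `Lie-gra`: the span of the connected directed simple graphs, with the same composition. -/
def LieGra (k : Type u) [Field k] : OperadData k where
  toSMod := graSet.lin k
  mul := graSet.linMul k fun S _ r g h =>
    sumOf k (X := {g : DGraph S // g.Connected}) fun G =>
      DGraph.IsComposite r g.1 (fun b => (h b).1) G.1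
  one S _ := Finsupp.lmapDomain k k fun s => ⟨DGraph.edgeless S ⟨s.1⟩, edgeless_connected s⟩

/-- The identification of `Com(S)` with the span of the graph without edges. -/
def comToNcGra (k : Type u) [Field k] : Fam (Com k).toSMod (LieNcGra k).toSMod :=
  fun S _ => Finsupp.lmapDomain k k fun x : PLift (Nonempty S) => DGraph.edgeless S x.down

/-- The inclusion of the connected graphs. -/
def graToNcGra (k : Type u) [Field k] : Fam (LieGra k).toSMod (LieNcGra k).toSMod :=
  fun S _ => Finsupp.lmapDomain k k fun x : {g : DGraph S // g.Connected} => x.1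

/-- The map `Com ∘ Lie-gra → Lie-ncgra ∘ Lie-ncgra → Lie-ncgra`. -/
def comGraToNcGra (k : Type u) [Field k] :
    Fam (comp (Com k).toSMod (LieGra k).toSMod) (LieNcGra k).toSMod :=
  fun S _ => (LieNcGra k).mul S ∘ₗ hcomp (comToNcGra k) (graToNcGra k) S

/-- The map `Lie-gra ∘ Com → Lie-ncgra ∘ Lie-ncgra → Lie-ncgra`. -/
def graComToNcGra (k : Type u) [Field k] :
    Fam (comp (LieGra k).toSMod (Com k).toSMod) (LieNcGra k).toSMod :=
  fun S _ => (LieNcGra k).mul S ∘ₗ hcomp (graToNcGra k) (comToNcGra k) S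

end
end GraphOperad

/-! Everything is computed inside the operad of all graphs. Fix a surjection `f : S → K`, that is, a
partition of `S` with labelled blocks. A graph `G` on `S` occurs in the composite of `g` with the
graphs `h j` exactly when `g` is the contraction of `G` along `f` (`quotRel`) and each `h j` is the
restriction of `G` to a fibre (`fibRel`). So `G` comes from at most one choice of graphs, with
coefficient one, and its coefficient in the composite of arbitrary decorations `p`, `q j` is the
coefficient of `p` at the contraction times the product of the coefficients of `q j` at the
restrictions. This is `coeff_mul_tree`; the operad axioms become statements about contracting and
restricting relations. Associativity says that contraction is transitive (`quotRel_quotRel`) and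
commutes with restriction (`quotRel_fibMap`).

The delicate point is that the contraction of an acyclic graph may have cycles. Coefficients are
therefore defined for all relations, as zero on those that are not graphs. The formula survives this
extension because a relation whose contraction and restrictions are all acyclic is itself acyclic
(`acyclic_of_quotRel`).

Edgeless graphs are closed under composition, and so are connected ones (`IsComposite.connected`).
Every graph is uniquely the disjoint union of its connected components, and inserting graphs into an
edgeless graph gives just their disjoint union. Hence the map `Φ : Com ∘ Lie-gra → Lie-ncgra`
matches basis trees with basis graphs and is bijective (`comGraToNcGra_bijective`).

The rest is formal. Put `Λ = Φ⁻¹ Ψ`. Each identity required of a distributive law may be tested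
after applying the injective map `Φ`, and then both sides become the same product in the ambient
operad, by its associativity and unit laws and `Φ Λ = Ψ` (`isDistributiveLaw_of_injective`). In the
same way `Φ` respects the composition of the composite operad (`compositeOperad_hom`). Operad axioms
pull back along injective maps that respect the structure (`IsOperadHom.isOperad`), so only
`Lie-ncgra` needs a direct verification. -/

namespace GraphOperad

universe u

open scoped TensorProduct DirectSum Classical

noncomputable section

variable {k : Type u} [Field k]

namespace SMod

/-! ### Composite products of families, naturality of the associator and of the unitors -/

section families

variable {P P' P'' Q Q' Q'' R R' : SMod k}

/-- The composition of families of linear maps. -/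
def famComp (φ' : Fam P' P'') (φ : Fam P P') : Fam P P'' := fun S _ => φ' S ∘ₗ φ S

theorem famComp_apply (φ' : Fam P' P'') (φ : Fam P P') (S : Type) [Finite S] (x : P.obj S) :
    famComp φ' φ S x = φ' S (φ S x) := rfl

theorem IsNatural.famComp {φ' : Fam P' P''} {φ : Fam P P'} (h' : IsNatural φ')
    (h : IsNatural φ) : IsNatural (famComp φ' φ) := fun e x => by
  rw [famComp_apply, famComp_apply, h, h']

theorem idFam_natural (P : SMod k) : IsNatural (idFam P) := fun _ _ => rfl

theorem hcomp_lof (φ : Fam P P') (ψ : Fam Q Q') (S : Type) [Finite S] (r : Setoid S)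
    (p : P.obj (Quotient r)) (q : ∀ b, Q.obj (Fib (Quotient.mk r) b)) :
    hcomp φ ψ S (DirectSum.lof k (Setoid S) (Summand P Q S) r (p ⊗ₜ PiTensorProduct.tprod k q)) =
      DirectSum.lof k (Setoid S) (Summand P' Q' S) r
        (φ _ p ⊗ₜ PiTensorProduct.tprod k fun b => ψ _ (q b)) := by
  refine (DirectSum.lmap_lof _ _ _).trans ?_
  rw [TensorProduct.map_tmul, PiTensorProduct.map_tprod]

theorem hcomp_tree_mk (φ : Fam P P') (ψ : Fam Q Q') {S : Type} [Finite S] (r : Setoid S)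
    (p : P.obj (Quotient r)) (q : ∀ b, Q.obj (Fib (Quotient.mk r) b)) :
    hcomp φ ψ S (tree (Quotient.mk r) Quotient.mk_surjective p q) =
      tree (Quotient.mk r) Quotient.mk_surjective (φ _ p) fun b => ψ _ (q b) := by
  rw [tree_mk, tree_mk, hcomp_lof]

/-- For a general surjection the decorations are first transported to the partition into fibres, so
naturality of both families is needed, unlike for quotient maps. The general form is unavoidable:
the associator produces trees over composites of quotient maps. -/
theorem hcomp_tree {φ : Fam P P'} {ψ : Fam Q Q'} (hφ : IsNatural φ) (hψ : IsNatural ψ)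
    {S K : Type} [Finite S] [Finite K] (f : S → K) (hf : Function.Surjective f) (p : P.obj K)
    (q : ∀ j, Q.obj (Fib f j)) :
    hcomp φ ψ S (tree f hf p q) = tree f hf (φ K p) fun j => ψ _ (q j) := by
  rw [tree_eq_lof, tree_eq_lof, hcomp_lof, hφ]
  simp only [hψ _ _]

theorem hcomp_hcomp (φ' : Fam P' P'') (ψ' : Fam Q' Q'') (φ : Fam P P') (ψ : Fam Q Q')
    (S : Type) [Finite S] (x : (comp P Q).obj S) :
    hcomp φ' ψ' S (hcomp φ ψ S x) = hcomp (famComp φ' φ) (famComp ψ' ψ) S x := by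
  refine LinearMap.congr_fun (f := hcomp φ' ψ' S ∘ₗ hcomp φ ψ S)
    (g := hcomp (famComp φ' φ) (famComp ψ' ψ) S) (comp_hom_ext fun r p q => ?_) x
  rw [LinearMap.comp_apply, hcomp_tree_mk, hcomp_tree_mk, hcomp_tree_mk]
  rfl

theorem hcomp_natural {φ : Fam P P'} {ψ : Fam Q Q'} (hφ : IsNatural φ) (hψ : IsNatural ψ) :
    IsNatural (hcomp φ ψ) := by
  intro S T _ _ e x
  refine LinearMap.congr_fun (f := hcomp φ ψ T ∘ₗ compMap P Q e)
    (g := compMap P' Q' e ∘ₗ hcomp φ ψ S) (comp_hom_ext fun r p q => ?_) x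
  rw [LinearMap.comp_apply, LinearMap.comp_apply, hcomp_tree_mk, compMap_tree, compMap_tree,
    hcomp_tree hφ hψ]
  simp only [hψ _ _]

/-- Linear maps out of `((P ∘ Q) ∘ R)(S)` are determined by their values on three-level trees. -/
theorem comp_comp_hom_ext {S : Type} [Finite S] {M : Type*} [AddCommGroup M] [Module k M]
    {φ ψ : compObj (comp P Q) R S →ₗ[k] M}
    (h : ∀ (r : Setoid S) (t : Setoid (Quotient r)) (p : P.obj (Quotient t))
      (q : ∀ b, Q.obj (Fib (Quotient.mk t) b)) (x : ∀ b, R.obj (Fib (Quotient.mk r) b)),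
      φ (tree (P := comp P Q) (Quotient.mk r) Quotient.mk_surjective
        (tree (Quotient.mk t) Quotient.mk_surjective p q) x) =
      ψ (tree (P := comp P Q) (Quotient.mk r) Quotient.mk_surjective
        (tree (Quotient.mk t) Quotient.mk_surjective p q) x)) : φ = ψ := by
  refine comp_hom_ext fun r p x => ?_
  let μ : compObj P Q (Quotient r) →ₗ[k] compObj (comp P Q) R S :=
    (mkL (comp P Q) R (Quotient.mk r) Quotient.mk_surjective).flip (PiTensorProduct.tprod k x)
  exact LinearMap.congr_fun (f := φ ∘ₗ μ) (g := ψ ∘ₗ μ)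
    (comp_hom_ext fun t p q => h r t p q x) p

theorem assoc_tree (P Q R : SMod k) {S : Type} [Finite S] (r : Setoid S) (t : Setoid (Quotient r))
    (p : P.obj (Quotient t)) (q : ∀ b, Q.obj (Fib (Quotient.mk t) b))
    (x : ∀ b, R.obj (Fib (Quotient.mk r) b)) :
    assoc P Q R S (tree (P := comp P Q) (Quotient.mk r) Quotient.mk_surjective
        (tree (Quotient.mk t) Quotient.mk_surjective p q) x) =
      tree (Quotient.mk t ∘ Quotient.mk r)
        (Quotient.mk_surjective.comp Quotient.mk_surjective) p
        (fun l => (tree (fibMap (Quotient.mk r) (Quotient.mk t) l)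
          (fibMap_surjective Quotient.mk_surjective _ l) (q l)
          fun d => R.map (fibFib (Quotient.mk r) (Quotient.mk t) l d) (x d.1) :
            compObj Q R (Fib (Quotient.mk t ∘ Quotient.mk r) l))) := by
  change assocHom P Q R S _ = _
  rw [tree_mk, assocHom, DirectSum.toModule_lof, TensorProduct.lift.tmul, tree_mk,
    DirectSum.toModule_lof, TensorProduct.curry_apply, assocTree_tprod]

/-- Three-level trees span the source, and on them both sides only rename the decorations. This
naturality lets the associativity of an operad be applied to elements coming from other `𝕊`-modules.
-/
theorem assoc_hcomp {φ : Fam P P'} {ψ : Fam Q Q'} {χ : Fam R R'} (hφ : IsNatural φ)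
    (hψ : IsNatural ψ) (hχ : IsNatural χ) (S : Type) [Finite S]
    (x : (comp (comp P Q) R).obj S) :
    assoc P' Q' R' S (hcomp (hcomp φ ψ) χ S x) =
      hcomp φ (hcomp ψ χ) S (assoc P Q R S x) := by
  refine LinearMap.congr_fun
    (f := (assoc P' Q' R' S).toLinearMap ∘ₗ hcomp (hcomp φ ψ) χ S)
    (g := hcomp φ (hcomp ψ χ) S ∘ₗ (assoc P Q R S).toLinearMap)
    (comp_comp_hom_ext fun r t p q x => ?_) x
  rw [LinearMap.comp_apply, LinearMap.comp_apply, LinearEquiv.coe_coe, LinearEquiv.coe_coe,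
    assoc_tree, hcomp_tree hφ (hcomp_natural hψ hχ), hcomp_tree_mk, hcomp_tree_mk, assoc_tree]
  congr 1
  funext l
  rw [hcomp_tree hψ hχ]
  simp only [hχ _ _]

/-- The generator of the unit `𝕊`-module on a one-element set. -/
def unitGen (k : Type u) [Field k] {S : Type} [Finite S] (s : {s : S // ∀ t, t = s}) :
    (unit k).obj S := (Finsupp.single s 1 : _ →₀ k)

theorem surjective_toUnit (S : Type) [Nonempty S] : Function.Surjective fun _ : S => () :=
  fun _ => ⟨Classical.arbitrary S, rfl⟩

theorem leftUnit_apply (P : SMod k) (S : Type) [Finite S] [h : Nonempty S] (x : P.obj S) :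
    leftUnit P S x = tree (fun _ : S => ()) (surjective_toUnit S)
      (unitGen k ⟨(), fun _ => rfl⟩)
      fun _ => P.map (Equiv.subtypeUnivEquiv fun _ => rfl).symm x := by
  rw [leftUnit, dif_pos h, LinearMap.comp_apply, LinearMap.comp_apply]
  refine congrArg _ ((PiTensorProduct.subsingletonEquiv_symm_apply _ _).trans ?_)
  congr 1

theorem rightUnit_apply (P : SMod k) (S : Type) [Finite S] (x : P.obj S) :
    rightUnit P S x = tree (id : S → S) Function.surjective_id x
      fun s => unitGen k ⟨⟨s, rfl⟩, fun t => Subtype.ext t.2⟩ := rfl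

theorem subsingleton_of_isEmpty (P : SMod k) (S : Type) [Finite S] (h : ¬ Nonempty S) :
    Subsingleton (P.obj S) :=
  have := not_nonempty_iff.1 h
  P.reduced S

theorem leftUnit_natural {φ : Fam P Q} (hφ : IsNatural φ) (S : Type) [Finite S] (x : P.obj S) :
    leftUnit Q S (φ S x) = hcomp (idFam _) φ S (leftUnit P S x) := by
  by_cases h : Nonempty S
  · rw [leftUnit_apply, leftUnit_apply, hcomp_tree (idFam_natural _) hφ]
    simp only [hφ _ _]
    rfl
  -- On the empty set `leftUnit` is zero by definition, and reducedness makes the target trivial.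
  · have := (comp (unit k) Q).subsingleton_of_isEmpty S h
    exact Subsingleton.elim _ _

theorem rightUnit_natural {φ : Fam P Q} (hφ : IsNatural φ) (S : Type) [Finite S] (x : P.obj S) :
    rightUnit Q S (φ S x) = hcomp φ (idFam _) S (rightUnit P S x) := by
  rw [rightUnit_apply, rightUnit_apply, hcomp_tree hφ (idFam_natural _)]
  rfl

end families

end SMod

open SMod

/-! ### Pulling operad axioms back along injective maps -/

section transport

variable {P R : OperadData k} {φ : Fam P.toSMod R.toSMod}

/-- A collection with the data of an operad that embeds into an operad is an operad. -/
theorem IsOperadHom.isOperad (h : IsOperadHom P R φ) (hR : IsOperad R)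
    (inj : ∀ (S : Type) [Finite S], Function.Injective (φ S)) : IsOperad P where
  one_natural {S T} _ _ e x := inj T (by
    rw [h.map_one, h.natural, h.map_one, hR.one_natural])
  mul_natural {S T} _ _ e x := inj T (by
    rw [h.map_mul, h.natural, h.map_mul, hcomp_natural h.natural h.natural, hR.mul_natural])
  mul_assoc S _ x := inj S (by
    have hmul : famComp φ P.mul = famComp R.mul (hcomp φ φ) := by
      funext S _
      exact LinearMap.ext fun x => h.map_mul S x
    rw [h.map_mul, h.map_mul, hcomp_hcomp, hcomp_hcomp, hmul]
    -- Associativity of `R` at the image of `x`; naturality of the associator turns it into the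
    -- image under `φ` of the equation wanted in `P`.
    have h1 := hR.mul_assoc S (hcomp (hcomp φ φ) φ S x)
    rw [assoc_hcomp h.natural h.natural h.natural, hcomp_hcomp, hcomp_hcomp] at h1
    exact h1)
  one_mul S _ x := inj S (by
    have hone : famComp φ P.one = R.one := by
      funext S _
      exact LinearMap.ext fun x => h.map_one S x
    have h1 := hR.one_mul S (φ S x)
    rw [leftUnit_natural h.natural, hcomp_hcomp] at h1
    rw [h.map_mul, hcomp_hcomp, hone]
    exact h1)
  mul_one S _ x := inj S (by
    have hone : famComp φ P.one = R.one := by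
      funext S _
      exact LinearMap.ext fun x => h.map_one S x
    have h1 := hR.mul_one S (φ S x)
    rw [rightUnit_natural h.natural, hcomp_hcomp] at h1
    rw [h.map_mul, hcomp_hcomp, hone]
    exact h1)

end transport

/-! ### Products of families with values in an operad -/

section product

variable {A A' B B' C : SMod k} {R : OperadData k}

/-- The product `A ∘ B → R ∘ R → R` of two families with values in an operad. -/
def famMul (R : OperadData k) (α : Fam A R.toSMod) (β : Fam B R.toSMod) :
    Fam (comp A B) R.toSMod := famComp R.mul (hcomp α β)

theorem famMul_natural (hR : IsOperad R) {α : Fam A R.toSMod} {β : Fam B R.toSMod}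
    (hα : IsNatural α) (hβ : IsNatural β) : IsNatural (famMul R α β) :=
  IsNatural.famComp hR.mul_natural (hcomp_natural hα hβ)

theorem famMul_hcomp (α : Fam A R.toSMod) (β : Fam B R.toSMod) (φ : Fam A' A) (ψ : Fam B' B)
    (S : Type) [Finite S] (x : (comp A' B').obj S) :
    famMul R α β S (hcomp φ ψ S x) = famMul R (famComp α φ) (famComp β ψ) S x := by
  rw [famMul, famComp_apply, hcomp_hcomp]
  rfl

/-- Associativity of `R` at the image of `x`, the associator being natural. Through this rule, its
inverse and the two unit rules, an identity between composites of structure maps becomes the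
rebracketing of a product in `R`. -/
theorem famMul_assoc (hR : IsOperad R) {α : Fam A R.toSMod} {β : Fam B R.toSMod}
    {χ : Fam C R.toSMod} (hα : IsNatural α) (hβ : IsNatural β) (hχ : IsNatural χ)
    (S : Type) [Finite S] (x : (comp (comp A B) C).obj S) :
    famMul R α (famMul R β χ) S (assoc A B C S x) = famMul R (famMul R α β) χ S x := by
  have h := hR.mul_assoc S (hcomp (hcomp α β) χ S x)
  rw [assoc_hcomp hα hβ hχ, hcomp_hcomp, hcomp_hcomp] at h
  exact h.symm

theorem famMul_assoc_symm (hR : IsOperad R) {α : Fam A R.toSMod} {β : Fam B R.toSMod}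
    {χ : Fam C R.toSMod} (hα : IsNatural α) (hβ : IsNatural β) (hχ : IsNatural χ)
    (S : Type) [Finite S] (x : (comp A (comp B C)).obj S) :
    famMul R (famMul R α β) χ S ((assoc A B C S).symm x) =
      famMul R α (famMul R β χ) S x := by
  rw [← famMul_assoc hR hα hβ hχ, LinearEquiv.apply_symm_apply]

theorem famMul_leftUnit (hR : IsOperad R) {α : Fam A R.toSMod} (hα : IsNatural α)
    (S : Type) [Finite S] (x : A.obj S) :
    famMul R R.one α S (leftUnit A S x) = α S x := by
  have h := hR.one_mul S (α S x)
  rw [leftUnit_natural hα, hcomp_hcomp] at h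
  exact h

theorem famMul_rightUnit (hR : IsOperad R) {α : Fam A R.toSMod} (hα : IsNatural α)
    (S : Type) [Finite S] (x : A.obj S) :
    famMul R α R.one S (rightUnit A S x) = α S x := by
  have h := hR.mul_one S (α S x)
  rw [rightUnit_natural hα, hcomp_hcomp] at h
  exact h

end product

/-! ### Distributive laws from an injective product `P ∘ Q → R` -/

section distributive

variable {P Q R : OperadData k} {i : Fam P.toSMod R.toSMod} {j : Fam Q.toSMod R.toSMod}

theorem IsOperadHom.famComp_mul (hi : IsOperadHom P R i) : famComp i P.mul = famMul R i i := by
  funext S _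
  exact LinearMap.ext fun x => hi.map_mul S x

theorem IsOperadHom.famComp_one (hi : IsOperadHom P R i) : famComp i P.one = R.one := by
  funext S _
  exact LinearMap.ext fun x => hi.map_one S x

variable {Λ : Fam (comp Q.toSMod P.toSMod) (comp P.toSMod Q.toSMod)}

/-- If the product `P ∘ Q → R` of two operad morphisms is injective, then the exchange of factors
in `R` is a distributive law. -/
theorem isDistributiveLaw_of_injective (hR : IsOperad R) (hi : IsOperadHom P R i)
    (hj : IsOperadHom Q R j)
    (inj : ∀ (S : Type) [Finite S], Function.Injective (famMul R i j S))
    (hΛ : famComp (famMul R i j) Λ = famMul R j i) : IsDistributiveLaw P Q Λ := by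
  have hΛ' : ∀ (S : Type) [Finite S] (x : (comp Q.toSMod P.toSMod).obj S),
      famMul R i j S (Λ S x) = famMul R j i S x := fun S _ x =>
    LinearMap.congr_fun (congrFun (congrFun hΛ S) _) x
  have hid : ∀ {A B : SMod k} (φ : Fam A B), famComp φ (idFam A) = φ := fun _ => rfl
  have ni : IsNatural i := hi.natural
  have nj : IsNatural j := hj.natural
  have nij : IsNatural (famMul R i j) := famMul_natural hR ni nj
  have nji : IsNatural (famMul R j i) := famMul_natural hR nj ni
  constructor
  · intro S T _ _ e x
    apply inj
    rw [hΛ', nji, nij, hΛ']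
  · intro S _ x
    apply inj
    -- In `R` both sides become the product `(j · i) · i` of `x`. On the right the successive forms
    -- are `(i · i) · j`, `i · (i · j)`, `i · (j · i)`, `(i · j) · i` and `(j · i) · i`: each `Λ`
    -- exchanges `i · j` for `j · i`.
    rw [hΛ', famMul_hcomp, hid, hi.famComp_mul, famMul_assoc hR nj ni ni,
      famMul_hcomp, hid, hi.famComp_mul, famMul_assoc_symm hR ni ni nj, famMul_hcomp, hid, hΛ,
      famMul_assoc hR ni nj ni, famMul_hcomp, hid, hΛ]
  · intro S _ x
    apply inj
    -- Both sides become `(j · j) · i`, the right one through `i · (j · j)`, `(i · j) · j`, `(j · i)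
    -- · j`, `j · (i · j)` and `j · (j · i)`.
    rw [hΛ', famMul_hcomp, hid, hj.famComp_mul, famMul_hcomp, hid, hj.famComp_mul,
      famMul_assoc hR ni nj nj, famMul_hcomp, hid, hΛ, famMul_assoc_symm hR nj ni nj,
      famMul_hcomp, hid, hΛ, famMul_assoc hR nj nj ni]
  · intro S _ x
    apply inj
    -- The unit of `Q` becomes that of `R`, so both sides have image `i x`; the last law is the same
    -- with `j`.
    rw [hΛ', famMul_hcomp, hid, famMul_hcomp, hid, hj.famComp_one, famMul_leftUnit hR ni,
      famMul_rightUnit hR ni]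
  · intro S _ x
    apply inj
    rw [hΛ', famMul_hcomp, hid, famMul_hcomp, hid, hi.famComp_one, famMul_leftUnit hR nj,
      famMul_rightUnit hR nj]

/-- Read from the outside in, each factor of the composition map of `P ∘ Q` is absorbed in `R`: the
products of `P` and `Q` give `(i · i) · (j · j)`, and rebracketing with one exchange in the middle
turns this into `(i · j) · (i · j)`. Injectivity plays no role here. -/
theorem compositeOperad_hom (hR : IsOperad R) (hi : IsOperadHom P R i)
    (hj : IsOperadHom Q R j) (hΛ : famComp (famMul R i j) Λ = famMul R j i) :
    IsOperadHom (compositeOperad P Q Λ) R (famMul R i j) := by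
  have hid : ∀ {A B : SMod k} (φ : Fam A B), famComp φ (idFam A) = φ := fun _ => rfl
  have ni : IsNatural i := hi.natural
  have nj : IsNatural j := hj.natural
  have nij : IsNatural (famMul R i j) := famMul_natural hR ni nj
  have nji : IsNatural (famMul R j i) := famMul_natural hR nj ni
  have njj : IsNatural (famMul R j j) := famMul_natural hR nj nj
  refine ⟨nij, fun S _ x => ?_, fun S _ x => ?_⟩
  · change famMul R i j S (hcomp P.mul Q.mul S ((assoc P.toSMod P.toSMod
      (comp Q.toSMod Q.toSMod) S).symm (hcomp (idFam P.toSMod)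
        (fun T _ => (assoc P.toSMod Q.toSMod Q.toSMod T).toLinearMap) S
      (hcomp (idFam P.toSMod) (hcomp Λ (idFam Q.toSMod)) S
      (hcomp (idFam P.toSMod)
        (fun T _ => (assoc Q.toSMod P.toSMod Q.toSMod T).symm.toLinearMap) S
      (assoc P.toSMod Q.toSMod (comp P.toSMod Q.toSMod) S x)))))) =
      famMul R (famMul R i j) (famMul R i j) S x
    -- The three inner factors act on the upper part of the tree only, below which sits an untouched
    -- copy of `P`. They are therefore recorded as equalities of families, which can be substituted
    -- in the second argument of `famMul`.
    have e1 : famComp (famMul R i (famMul R j j))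
        (fun T _ => (assoc P.toSMod Q.toSMod Q.toSMod T).toLinearMap) =
        famMul R (famMul R i j) j := by
      funext T _
      exact LinearMap.ext fun y => famMul_assoc hR ni nj nj T y
    have e2 : famComp (famMul R (famMul R i j) j) (hcomp Λ (idFam Q.toSMod)) =
        famMul R (famMul R j i) j := by
      funext T _
      refine LinearMap.ext fun y => ?_
      rw [famComp_apply, famMul_hcomp, hid, hΛ]
    have e3 : famComp (famMul R (famMul R j i) j)
        (fun T _ => (assoc Q.toSMod P.toSMod Q.toSMod T).symm.toLinearMap) =
        famMul R j (famMul R i j) := by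
      funext T _
      exact LinearMap.ext fun y => famMul_assoc_symm hR nj ni nj T y
    rw [famMul_hcomp, hi.famComp_mul, hj.famComp_mul, famMul_assoc_symm hR ni ni njj,
      famMul_hcomp, hid, e1, famMul_hcomp, hid, e2, famMul_hcomp, hid, e3]
    exact famMul_assoc hR ni nj nij S x
  · change famMul R i j S (hcomp P.one Q.one S (rightUnit (unit k) S x)) = R.one S x
    rw [famMul_hcomp, hi.famComp_one, hj.famComp_one, famMul_rightUnit hR hR.one_natural]

end distributive

/-! ### Contraction and restriction of relations -/

/-- The relation induced on the target of a map, without loops. -/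
def quotRel {S K : Type} (f : S → K) (A : S → S → Prop) : K → K → Prop := fun b b' =>
  b ≠ b' ∧ ∃ x y, f x = b ∧ f y = b' ∧ A x y

/-- The relation induced on a fibre of a map. -/
def fibRel {S K : Type} (f : S → K) (A : S → S → Prop) (j : K) : Fib f j → Fib f j → Prop :=
  fun x y => A x.1 y.1

/-- Relations without directed cycles. -/
def Acyclic {S : Type} (A : S → S → Prop) : Prop := ∀ x, ¬ Relation.TransGen A x x

theorem Acyclic.comap {S T : Type} {A : T → T → Prop} (h : Acyclic A) (e : S → T) :
    Acyclic fun a b => A (e a) (e b) := fun x hx =>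
  h (e x) (Relation.TransGen.lift (p := A) e (fun _ _ h => h) x x hx)

theorem acyclic_comap_equiv {S T : Type} {A : T → T → Prop} (e : S ≃ T) :
    (Acyclic fun a b => A (e a) (e b)) ↔ Acyclic A :=
  ⟨fun h => by simpa using h.comap e.symm, fun h => h.comap e⟩

theorem acyclic_of_quotRel {S K : Type} (f : S → K) {A : S → S → Prop}
    (h : Acyclic (quotRel f A)) (h' : ∀ j, Acyclic (fibRel f A j)) : Acyclic A := by
  -- A path either never leaves the fibre in which it starts, or projects to a non-empty path in the
  -- contraction. A closed path thus gives a cycle in a fibre or in the contraction.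
  have key : ∀ x y, Relation.TransGen A x y → Relation.TransGen (quotRel f A) (f x) (f y) ∨
      ∃ e : f y = f x, Relation.TransGen (fibRel f A (f x)) ⟨x, rfl⟩ ⟨y, e⟩ := by
    intro x y hxy
    induction hxy with
    | @single y hy =>
      by_cases e : f y = f x
      · exact Or.inr ⟨e, .single hy⟩
      · exact Or.inl (.single ⟨Ne.symm e, x, y, rfl, rfl, hy⟩)
    | @tail y z _ hyz ih =>
      by_cases e : f z = f y
      · rcases ih with ih | ⟨e', ih⟩
        · exact Or.inl (e ▸ ih)
        · exact Or.inr ⟨e.trans e', ih.tail hyz⟩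
      · have hq : quotRel f A (f y) (f z) := ⟨Ne.symm e, y, z, rfl, rfl, hyz⟩
        rcases ih with ih | ⟨e', ih⟩
        · exact Or.inl (ih.tail hq)
        · exact Or.inl (.single (e' ▸ hq))
  intro x hx
  rcases key x x hx with hx | ⟨_, hx⟩
  · exact h _ hx
  · exact h' _ _ hx

/-- The loops dropped in the first contraction would also be loops in the second, since distinct
images under `g ∘ f` force distinct images under `f`. -/
theorem quotRel_quotRel {S K L : Type} (f : S → K) (g : K → L) (A : S → S → Prop) :
    quotRel g (quotRel f A) = quotRel (g ∘ f) A := by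
  funext b b'
  refine propext ⟨?_, ?_⟩
  · rintro ⟨hb, _, _, hx, hy, -, x, y, rfl, rfl, h⟩
    exact ⟨hb, x, y, hx, hy, h⟩
  · rintro ⟨hb, x, y, rfl, rfl, h⟩
    exact ⟨hb, f x, f y, rfl, rfl, fun e => hb (congrArg g e), x, y, rfl, rfl, h⟩

/-- An edge whose contraction lies over `l` already has both ends over `l`, so contracting inside
the part of `S` over `l` loses nothing. -/
theorem quotRel_fibMap {S K L : Type} (f : S → K) (g : K → L) (A : S → S → Prop) (l : L) :
    quotRel (fibMap f g l) (fibRel (g ∘ f) A l) = fibRel g (quotRel f A) l := by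
  funext b b'
  refine propext ⟨?_, ?_⟩
  · rintro ⟨hb, x, y, rfl, rfl, h⟩
    exact ⟨fun e => hb (Subtype.ext e), x.1, y.1, rfl, rfl, h⟩
  · obtain ⟨b, rfl⟩ := b
    obtain ⟨b', hb'⟩ := b'
    rintro ⟨hb, x, y, rfl, rfl, h⟩
    exact ⟨fun e => hb (congrArg Subtype.val e), ⟨x, rfl⟩, ⟨y, hb'⟩, rfl, rfl, h⟩

theorem quotRel_comp_symm {S T K : Type} (e : S ≃ T) (f : S → K) (A : T → T → Prop) :
    quotRel (f ∘ e.symm) A = quotRel f fun x y => A (e x) (e y) := by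
  funext b b'
  refine propext ⟨?_, ?_⟩
  · rintro ⟨hb, x, y, hx, hy, h⟩
    exact ⟨hb, e.symm x, e.symm y, hx, hy, by simpa using h⟩
  · rintro ⟨hb, x, y, rfl, rfl, h⟩
    exact ⟨hb, e x, e y, by simp, by simp, h⟩

theorem quotRel_equiv {S K K' : Type} (σ : K ≃ K') (f : S → K) (A : S → S → Prop) :
    (fun a b => quotRel f A (σ.symm a) (σ.symm b)) = quotRel (σ ∘ f) A := by
  funext b b'
  simp [quotRel, Equiv.eq_symm_apply]

namespace DGraph

theorem not_adj_self {S : Type} (G : DGraph S) (x : S) : ¬ G.Adj x x := fun h =>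
  G.acyclic x (.single h)

/-- The composite graph determines its constituents. This is why at most one term contributes to
each coefficient of a product. -/
theorem isComposite_iff {S : Type} {r : Setoid S} {g : DGraph (Quotient r)}
    {h : ∀ b, DGraph (Fib (Quotient.mk r) b)} {G : DGraph S} :
    IsComposite r g h G ↔ g.Adj = quotRel (Quotient.mk r) G.Adj ∧
      ∀ b, (h b).Adj = fibRel (Quotient.mk r) G.Adj b := by
  constructor
  · rintro ⟨h1, h2⟩
    refine ⟨?_, fun b => funext fun x => funext fun y => propext (h1 b x y)⟩
    funext b b'
    -- `IsComposite` is silent on the diagonal; there `g` has no loop by acyclicity and `quotRel`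
    -- has none by definition.
    by_cases hb : b = b'
    · subst hb
      exact propext ⟨fun h => (g.not_adj_self b h).elim, fun h => (h.1 rfl).elim⟩
    · exact propext ((h2 b b' hb).trans ⟨fun h => ⟨hb, h⟩, fun h => h.2⟩)
  · rintro ⟨h1, h2⟩
    refine ⟨fun b x y => by rw [h2]; rfl, fun b b' hb => ?_⟩
    rw [h1]
    exact ⟨fun h => h.2, fun h => ⟨hb, h⟩⟩

end DGraph

/-! ### Coefficients and the product formula -/

/-- The coefficient of a relation in a linear combination of graphs, zero if the relation is not
a graph. -/
def coeff {S : Type} [Finite S] (x : (LieNcGra k).toSMod.obj S) (A : S → S → Prop) : k :=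
  if h : Nonempty S ∧ Acyclic A then (show DGraph S →₀ k from x) ⟨A, h.2, h.1⟩ else 0

theorem coeff_adj {S : Type} [Finite S] (x : (LieNcGra k).toSMod.obj S) (G : DGraph S) :
    coeff x G.Adj = (show DGraph S →₀ k from x) G :=
  dif_pos (⟨G.nonempty, G.acyclic⟩ : Nonempty S ∧ Acyclic G.Adj)

theorem coeff_ext {S : Type} [Finite S] {x y : (LieNcGra k).toSMod.obj S}
    (h : ∀ G : DGraph S, coeff x G.Adj = coeff y G.Adj) : x = y := by
  refine Finsupp.ext fun G => ?_
  exact (coeff_adj x G).symm.trans ((h G).trans (coeff_adj y G))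

theorem coeff_map {S T : Type} [Finite S] [Finite T] (e : S ≃ T) (x : (LieNcGra k).toSMod.obj S)
    (A : T → T → Prop) :
    coeff ((LieNcGra k).toSMod.map e x) A = coeff x fun a b => A (e a) (e b) := by
  unfold coeff
  have hc : (Nonempty S ∧ Acyclic fun a b => A (e a) (e b)) ↔ (Nonempty T ∧ Acyclic A) := by
    rw [acyclic_comap_equiv, e.nonempty_congr]
  by_cases h : Nonempty T ∧ Acyclic A
  · rw [dif_pos h, dif_pos (hc.2 h)]
    have hG : (⟨A, h.2, h.1⟩ : DGraph T) = DGraph.map e ⟨_, (hc.2 h).2, (hc.2 h).1⟩ := by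
      ext x y
      simp [DGraph.map]
    rw [hG]
    refine Finsupp.mapDomain_apply (f := DGraph.map e) (fun g g' hg => ?_) x _
    ext x y
    have := congrFun (congrFun (congrArg DGraph.Adj hg) (e x)) (e y)
    simpa [DGraph.map] using this
  · rw [dif_neg h, dif_neg (fun h' => h (hc.1 h'))]

/-- A graph as an element of the operad of graphs. -/
def graphElt (k : Type u) [Field k] {S : Type} [Finite S] (g : DGraph S) :
    (LieNcGra k).toSMod.obj S := (Finsupp.single g 1 : DGraph S →₀ k)

theorem coeff_graphElt {S : Type} [Finite S] (g : DGraph S) (A : S → S → Prop) :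
    coeff (graphElt k g) A = if g.Adj = A then 1 else 0 := by
  by_cases h : Nonempty S ∧ Acyclic A
  · refine (dif_pos h).trans ((Finsupp.single_apply).trans ?_)
    congr 1
    exact propext DGraph.ext_iff
  · rw [coeff, dif_neg h, if_neg]
    rintro rfl
    exact h ⟨g.nonempty, g.acyclic⟩

theorem coeff_sumOf {S : Type} [Finite S] (p : DGraph S → Prop) (G : DGraph S) :
    coeff (k := k) (sumOf k p : DGraph S →₀ k) G.Adj = if p G then 1 else 0 :=
  (coeff_adj _ G).trans rfl

/-- Multilinear expansion for arbitrary decorations, not only basis elements: in an iterated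
composite the inner products are themselves sums. -/
theorem SetSMod.linMul_tree_apply (X : SetSMod)
    (F : ∀ (S : Type) [Finite S] (r : Setoid S), X.obj (Quotient r) →
      (∀ b, X.obj (Fib (Quotient.mk r) b)) → (X.obj S →₀ k)) (S : Type) [Finite S] (r : Setoid S)
    [hX : Fintype (X.obj (Quotient r) × ∀ b, X.obj (Fib (Quotient.mk r) b))]
    (p : (X.lin k).obj (Quotient r)) (q : ∀ b, (X.lin k).obj (Fib (Quotient.mk r) b)) :
    X.linMul k F S (tree (P := X.lin k) (Q := X.lin k) (Quotient.mk r) Quotient.mk_surjective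
      p q) = ∑ a : X.obj (Quotient r) × ∀ b, X.obj (Fib (Quotient.mk r) b),
        (p a.1 * ∏ᶠ b, q b (a.2 b)) • F S r a.1 a.2 := by
  let := Fintype.ofFinite (Quotient r)
  refine (congrArg _ (tree_mk (P := X.lin k) (Q := X.lin k) r p q)).trans ?_
  rw [linMul]
  refine (DirectSum.toModule_lof k r _).trans ?_
  rw [LinearMap.comp_apply, LinearMap.comp_apply, Finsupp.linearCombination_apply]
  refine (Finsupp.sum_fintype _ _ fun a => zero_smul k (F S r a.1 a.2)).trans ?_
  refine Finset.sum_congr rfl fun a _ => ?_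
  congr 1
  refine (finsuppTensorFinsupp'_apply_apply _ _ _ _ _ _ _).trans ?_
  rw [finprod_eq_prod_of_fintype]
  congr 1
  refine (PiTensorProduct.ofFinsuppEquiv'_apply_apply _ _).trans ?_
  congr!

theorem coeff_mul_tree_mk {S : Type} [Finite S] (r : Setoid S)
    (p : (LieNcGra k).toSMod.obj (Quotient r))
    (q : ∀ b, (LieNcGra k).toSMod.obj (Fib (Quotient.mk r) b)) (G : DGraph S) :
    coeff ((LieNcGra k).mul S (tree (Quotient.mk r) Quotient.mk_surjective p q)) G.Adj =
      coeff p (quotRel (Quotient.mk r) G.Adj) *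
        ∏ᶠ b, coeff (q b) (fibRel (Quotient.mk r) G.Adj b) := by
  have I : Fintype (DGraph (Quotient r) × ∀ b, DGraph (Fib (Quotient.mk r) b)) :=
    Fintype.ofFinite _
  rw [coeff_adj]
  have hsum : (show DGraph S →₀ k from (LieNcGra k).mul S
      (tree (Quotient.mk r) Quotient.mk_surjective p q)) =
      ∑ a : DGraph (Quotient r) × ∀ b, DGraph (Fib (Quotient.mk r) b),
        ((show DGraph (Quotient r) →₀ k from p) a.1 *
          ∏ᶠ b, (show DGraph (Fib (Quotient.mk r) b) →₀ k from q b) (a.2 b)) •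
        (sumOf k (fun G => DGraph.IsComposite r a.1 a.2 G) : DGraph S →₀ k) :=
    ncGraSet.linMul_tree_apply (k := k) (hX := I) (fun S _ r g h =>
      sumOf k (X := DGraph S) fun G => DGraph.IsComposite r g h G) S r p q
  refine (DFunLike.congr_fun hsum G).trans ?_
  refine (Finsupp.finsetSum_apply _ _ _).trans ?_
  have hval : ∀ a : DGraph (Quotient r) × ∀ b, DGraph (Fib (Quotient.mk r) b),
      (sumOf k (fun G => DGraph.IsComposite r a.1 a.2 G) : DGraph S →₀ k) G =
        if a.1.Adj = quotRel (Quotient.mk r) G.Adj ∧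
          ∀ b, (a.2 b).Adj = fibRel (Quotient.mk r) G.Adj b then 1 else 0 := fun a => by
    rw [← if_congr DGraph.isComposite_iff rfl rfl]
    rfl
  have hn : Nonempty (Quotient r) := G.nonempty.map (Quotient.mk r)
  let H : ∀ b, DGraph (Fib (Quotient.mk r) b) := fun b =>
    ⟨fibRel (Quotient.mk r) G.Adj b, Acyclic.comap G.acyclic Subtype.val,
      (Quotient.mk_surjective b).elim fun s hs => ⟨⟨s, hs⟩⟩⟩
  by_cases h : Acyclic (quotRel (Quotient.mk r) G.Adj)
  · let g : DGraph (Quotient r) := ⟨quotRel (Quotient.mk r) G.Adj, h, hn⟩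
    -- Only the contraction and the restrictions of `G` itself have `G` in their composite.
    refine (Finset.sum_eq_single (g, H) ?_ (fun h => (h (Finset.mem_univ _)).elim)).trans ?_
    · intro a _ ha
      refine (congrArg (fun z => _ * z) (hval a)).trans ?_
      rw [if_neg, mul_zero]
      rintro ⟨h1, h2⟩
      exact ha (Prod.ext (DGraph.ext h1) (funext fun b => DGraph.ext (h2 b)))
    · refine (congrArg (fun z => _ * z) ((hval (g, H)).trans
        (if_pos ⟨rfl, fun b => rfl⟩))).trans ?_
      rw [mul_one, coeff_adj p g]
      congr 1
      exact finprod_congr fun b => (coeff_adj (q b) (H b)).symm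
  -- If the contraction of `G` has a cycle, no root graph yields `G`, in agreement with the value
  -- zero of `coeff` there.
  · rw [coeff, dif_neg fun h' => h h'.2, zero_mul]
    refine Finset.sum_eq_zero fun a _ => (congrArg (fun z => _ * z) (hval a)).trans ?_
    rw [if_neg, mul_zero]
    rintro ⟨h1, -⟩
    exact h (h1 ▸ a.1.acyclic)

/-- For graphs this is the case of a quotient map, relabelled along the bijection between classes
and `K`. That `A` may be any relation matters when the formula is iterated: the inner factor is then
evaluated at a contraction, which may have cycles. -/
theorem coeff_mul_tree {S K : Type} [Finite S] [Finite K] (f : S → K)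
    (hf : Function.Surjective f) (p : (LieNcGra k).toSMod.obj K)
    (q : ∀ j, (LieNcGra k).toSMod.obj (Fib f j)) (A : S → S → Prop) :
    coeff ((LieNcGra k).mul S (tree f hf p q)) A =
      coeff p (quotRel f A) * ∏ᶠ j, coeff (q j) (fibRel f A j) := by
  by_cases h : Nonempty S ∧ Acyclic A
  · let σ := Setoid.quotientKerEquivOfSurjective f hf
    have h1 := coeff_mul_tree_mk (k := k) (Setoid.ker f) ((LieNcGra k).toSMod.map σ.symm p)
      (fun b => (LieNcGra k).toSMod.map (fibEquiv (Equiv.refl S) (fun s => by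
          rw [← σ.injective.eq_iff]
          rfl)) (q (σ b))) ⟨A, h.2, h.1⟩
    rw [tree_mk, ← tree_eq_lof] at h1
    rw [h1, coeff_map]
    simp only [coeff_map]
    rw [← finprod_comp_equiv σ]
    congr 2
    exact quotRel_equiv σ _ A
  · rw [coeff, dif_neg h, eq_comm]
    by_cases h' : Nonempty K ∧ Acyclic (quotRel f A)
    -- Here `A` must have a cycle although its contraction has none, so some restriction has a cycle
    -- and contributes a zero factor.
    · have hS : Nonempty S := h'.1.elim fun j => (hf j).elim fun s _ => ⟨s⟩
      have hj : ∃ j, ¬ Acyclic (fibRel f A j) := by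
        by_contra! hj
        exact h ⟨hS, acyclic_of_quotRel f h'.2 hj⟩
      obtain ⟨j, hj⟩ := hj
      have := Fintype.ofFinite K
      rw [finprod_eq_prod_of_fintype, Finset.prod_eq_zero (Finset.mem_univ j), mul_zero]
      exact dif_neg fun h => hj h.2
    · rw [coeff, dif_neg h', zero_mul]

/-! ### The operad axioms for graphs -/

theorem lieNcGra_one_unitGen {S : Type} [Finite S] (s : {s : S // ∀ t, t = s}) :
    (LieNcGra k).one S (unitGen k s) = graphElt k (DGraph.edgeless S ⟨s.1⟩) :=
  Finsupp.mapDomain_single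

/-- A graph has no loops, so pulled back to a single point it is the edgeless graph. Inputs
decorated by the unit hence contribute a factor one to every coefficient. -/
theorem coeff_one_unitGen {S T : Type} [Finite S] (s : {s : S // ∀ t, t = s}) (G : DGraph T)
    (f : S → T) :
    coeff ((LieNcGra k).one S (unitGen k s)) (fun x y => G.Adj (f x) (f y)) = 1 := by
  rw [lieNcGra_one_unitGen, coeff_graphElt, if_pos]
  funext x y
  rw [s.2 x, s.2 y]
  exact propext ⟨fun h => h.elim, G.not_adj_self _⟩

theorem unit_hom_ext {S : Type} [Finite S] {M : Type*} [AddCommGroup M] [Module k M]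
    {φ ψ : (unit k).obj S →ₗ[k] M} (h : ∀ s, φ (unitGen k s) = ψ (unitGen k s)) : φ = ψ :=
  Finsupp.lhom_ext' fun s => LinearMap.ext_ring (h s)

theorem one_natural_of_unitGen {P : SMod k} {φ : Fam (unit k) P}
    (h : ∀ {S T : Type} [Finite S] [Finite T] (e : S ≃ T) (s : {s : S // ∀ t, t = s})
      (t : {t : T // ∀ t', t' = t}),
      φ T (unitGen k t) = P.map e (φ S (unitGen k s))) : IsNatural φ := by
  intro S T _ _ e x
  refine LinearMap.congr_fun (f := φ T ∘ₗ (unit k).map e) (g := P.map e ∘ₗ φ S)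
    (unit_hom_ext fun s => ?_) x
  refine Eq.trans ?_ (h e s ⟨e s.1, fun t => by rw [← s.2 (e.symm t), e.apply_symm_apply]⟩)
  exact congrArg (φ T) Finsupp.mapDomain_single

theorem lieNcGra_one_natural : IsNatural (LieNcGra k).one :=
  one_natural_of_unitGen fun {S T} _ _ e s t => by
    rw [lieNcGra_one_unitGen, lieNcGra_one_unitGen]
    exact (Finsupp.mapDomain_single (f := DGraph.map e) (a := DGraph.edgeless S ⟨s.1⟩)
      (b := (1 : k))).symm

theorem lieNcGra_mul_natural : IsNatural (LieNcGra k).mul := by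
  intro S T _ _ e x
  refine LinearMap.congr_fun
    (f := (LieNcGra k).mul T ∘ₗ compMap (LieNcGra k).toSMod (LieNcGra k).toSMod e)
    (g := (LieNcGra k).toSMod.map e ∘ₗ (LieNcGra k).mul S) (comp_hom_ext fun r p q => ?_) x
  rw [LinearMap.comp_apply, LinearMap.comp_apply, compMap_tree]
  refine coeff_ext fun G => ?_
  rw [coeff_map, coeff_mul_tree, coeff_mul_tree, quotRel_comp_symm]
  simp only [coeff_map]
  rfl

theorem finprod_fib {K L : Type} [Finite K] [Finite L] (g : K → L) (F : K → k) :
    ∏ᶠ l, ∏ᶠ d : Fib g l, F d.1 = ∏ᶠ j, F j := by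
  have := Fintype.ofFinite K
  have := Fintype.ofFinite L
  simp only [finprod_eq_prod_of_fintype]
  rw [← (Equiv.sigmaFiberEquiv g).prod_comp, Fintype.prod_sigma]
  rfl

/-- Two applications of the product formula to either side give three factors: `p` at the total
contraction, the `q l` at contracted restrictions and the `x b` at restrictions. They agree by the
two commutation rules for `quotRel` and by grouping the last product over the fibres of the upper
partition. -/
theorem lieNcGra_mul_assoc (S : Type) [Finite S] (x : (comp (comp (LieNcGra k).toSMod
    (LieNcGra k).toSMod) (LieNcGra k).toSMod).obj S) :
    (LieNcGra k).mul S (hcomp (LieNcGra k).mul (idFam _) S x) =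
      (LieNcGra k).mul S (hcomp (idFam _) (LieNcGra k).mul S (assoc _ _ _ S x)) := by
  refine LinearMap.congr_fun
    (f := (LieNcGra k).mul S ∘ₗ hcomp (LieNcGra k).mul (idFam _) S)
    (g := (LieNcGra k).mul S ∘ₗ hcomp (idFam _) (LieNcGra k).mul S ∘ₗ
      (assoc (LieNcGra k).toSMod (LieNcGra k).toSMod (LieNcGra k).toSMod S).toLinearMap)
    (comp_comp_hom_ext fun r t p q x => ?_) x
  rw [LinearMap.comp_apply, LinearMap.comp_apply, LinearMap.comp_apply, LinearEquiv.coe_coe,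
    assoc_tree, hcomp_tree_mk, hcomp_tree (idFam_natural _) lieNcGra_mul_natural]
  refine coeff_ext fun G => ?_
  rw [coeff_mul_tree, coeff_mul_tree]
  refine Eq.trans ?_ (coeff_mul_tree (Quotient.mk t ∘ Quotient.mk r)
    (Quotient.mk_surjective.comp Quotient.mk_surjective) _ _ _).symm
  refine Eq.trans ?_ (congrArg (fun z => _ * z) (finprod_congr fun l => (coeff_mul_tree
    (fibMap (Quotient.mk r) (Quotient.mk t) l) (fibMap_surjective Quotient.mk_surjective _ l)
    (q l) _ _).symm))
  simp only [idFam, LinearMap.id_apply, coeff_map]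
  rw [finprod_mul_distrib (Set.toFinite _) (Set.toFinite _), ← mul_assoc, quotRel_quotRel]
  simp only [quotRel_fibMap]
  congr 1
  exact (finprod_fib (Quotient.mk t)
    fun b => coeff (x b) (fibRel (Quotient.mk r) G.Adj b)).symm

theorem lieNcGra_one_mul (S : Type) [Finite S] (x : (LieNcGra k).toSMod.obj S) :
    (LieNcGra k).mul S (hcomp (LieNcGra k).one (idFam _) S (leftUnit _ S x)) = x := by
  refine coeff_ext fun G => ?_
  have := G.nonempty
  rw [leftUnit_apply, hcomp_tree lieNcGra_one_natural (idFam_natural _), coeff_mul_tree]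
  -- Both relations on the point are empty; writing the empty one through a vertex of `G` matches
  -- the shape of `coeff_one_unitGen`.
  have h : quotRel (fun _ : S => ()) G.Adj = fun _ _ => G.Adj this.some this.some := by
    funext _ _
    exact propext ⟨fun h => (h.1 rfl).elim, fun h => (G.not_adj_self _ h).elim⟩
  rw [h, coeff_one_unitGen _ G, one_mul, finprod_unique]
  exact (coeff_map _ _ _).trans rfl

theorem lieNcGra_mul_one (S : Type) [Finite S] (x : (LieNcGra k).toSMod.obj S) :
    (LieNcGra k).mul S (hcomp (idFam _) (LieNcGra k).one S (rightUnit _ S x)) = x := by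
  refine coeff_ext fun G => ?_
  rw [rightUnit_apply, hcomp_tree (idFam_natural _) lieNcGra_one_natural, coeff_mul_tree]
  have h : quotRel (id : S → S) G.Adj = G.Adj := by
    funext a b
    refine propext ⟨?_, fun h => ⟨?_, a, b, rfl, rfl, h⟩⟩
    · rintro ⟨-, _, _, rfl, rfl, h⟩
      exact h
    · rintro rfl
      exact G.not_adj_self _ h
  have h1 : ∀ s : S, coeff ((LieNcGra k).one _ (unitGen k (S := Fib (id : S → S) s)
      ⟨⟨s, rfl⟩, fun t => Subtype.ext t.2⟩)) (fibRel id G.Adj s) = 1 := fun s =>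
    coeff_one_unitGen _ G _
  rw [h]
  simp only [h1, finprod_one, mul_one]
  rfl

theorem lieNcGra_isOperad : IsOperad (LieNcGra k) :=
  ⟨lieNcGra_mul_natural, lieNcGra_one_natural, lieNcGra_mul_assoc, lieNcGra_one_mul,
    lieNcGra_mul_one⟩

/-! ### Partial compositions -/

/-- Every fibre of `insertMap` other than the one over `a` is a point. The four clauses of an
insertion thus describe the contraction on pairs away from `a`, on pairs ending or starting at `a`,
and the restriction to `T`. -/
theorem isInsertion_iff {S T : Type} (a : S) (g : DGraph S) (h : DGraph T)
    (G : DGraph ({s : S // s ≠ a} ⊕ T)) :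
    DGraph.IsInsertion a g h G ↔ g.Adj = quotRel (insertMap a T) G.Adj ∧
      h.Adj = fun x y => G.Adj (Sum.inr x) (Sum.inr y) := by
  have h1 : ∀ s s' : {s : S // s ≠ a},
      quotRel (insertMap a T) G.Adj s s' ↔ G.Adj (Sum.inl s) (Sum.inl s') := by
    intro s s'
    constructor
    · rintro ⟨-, x | x, y | y, hx, hy, hxy⟩
      · rwa [← show x = s from Subtype.ext hx, ← show y = s' from Subtype.ext hy]
      · exact (s'.2 hy.symm).elim
      · exact (s.2 hx.symm).elim
      · exact (s.2 hx.symm).elim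
    · refine fun hs => ⟨fun e => ?_, _, _, rfl, rfl, hs⟩
      rw [show s = s' from Subtype.ext e] at hs
      exact G.not_adj_self _ hs
  have h2 : ∀ s : {s : S // s ≠ a},
      quotRel (insertMap a T) G.Adj s a ↔ ∃ t, G.Adj (Sum.inl s) (Sum.inr t) := by
    intro s
    constructor
    · rintro ⟨-, x | x, y | y, hx, hy, hxy⟩
      · exact (y.2 hy).elim
      · rw [← show x = s from Subtype.ext hx]
        exact ⟨y, hxy⟩
      · exact (s.2 hx.symm).elim
      · exact (s.2 hx.symm).elim
    · exact fun ⟨t, ht⟩ => ⟨s.2, _, _, rfl, rfl, ht⟩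
  have h3 : ∀ s : {s : S // s ≠ a},
      quotRel (insertMap a T) G.Adj a s ↔ ∃ t, G.Adj (Sum.inr t) (Sum.inl s) := by
    intro s
    constructor
    · rintro ⟨-, x | x, y | y, hx, hy, hxy⟩
      · exact (x.2 hx).elim
      · exact (x.2 hx).elim
      · rw [← show y = s from Subtype.ext hy]
        exact ⟨x, hxy⟩
      · exact (s.2 hy.symm).elim
    · exact fun ⟨t, ht⟩ => ⟨s.2.symm, _, _, rfl, rfl, ht⟩
  constructor
  · rintro ⟨i1, i2, i3, i4⟩
    refine ⟨?_, funext fun x => funext fun y => propext (i2 x y).symm⟩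
    funext s s'
    refine propext ?_
    by_cases hs : s = a
    · subst hs
      by_cases hs' : s' = s
      · subst hs'
        exact ⟨fun h => (g.not_adj_self _ h).elim, fun h => (h.1 rfl).elim⟩
      · exact (i4 ⟨s', hs'⟩).symm.trans (h3 ⟨s', hs'⟩).symm
    · by_cases hs' : s' = a
      · subst hs'
        exact (i3 ⟨s, hs⟩).symm.trans (h2 ⟨s, hs⟩).symm
      · exact (i1 ⟨s, hs⟩ ⟨s', hs'⟩).symm.trans (h1 ⟨s, hs⟩ ⟨s', hs'⟩).symm
  · rintro ⟨e1, e2⟩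
    refine ⟨fun s s' => ?_, fun t t' => ?_, fun s => ?_, fun s => ?_⟩
    · rw [e1, h1]
    · rw [e2]
    · rw [e1, h2]
    · rw [e1, h3]

theorem lieNcGra_circ (S T : Type) [Finite S] [Finite T] [Nonempty T] (a : S)
    (g : DGraph S) (h : DGraph T) :
    (LieNcGra k).circ a (graphElt k g) (graphElt k h) =
      (sumOf k fun G => DGraph.IsInsertion a g h G :
        DGraph ({s : S // s ≠ a} ⊕ T) →₀ k) := by
  refine coeff_ext fun G => ?_
  -- Only the fibre over `a` contributes a nontrivial factor, the others being decorated by units.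
  rw [coeff_sumOf, OperadData.circ, coeff_mul_tree, finprod_eq_single _ a, dif_pos rfl,
    coeff_map, coeff_graphElt, coeff_graphElt, if_congr (isInsertion_iff a g h G) rfl rfl,
    ite_and]
  · by_cases h1 : g.Adj = quotRel (insertMap a T) G.Adj
    · rw [if_pos h1, if_pos h1, one_mul]
      rfl
    · rw [if_neg h1, if_neg h1, zero_mul]
  · intro s hs
    rw [dif_neg hs]
    exact coeff_one_unitGen _ G _

/-! ### Linearised maps of set-valued `𝕊`-modules -/

namespace SetSMod

variable {X Y : SetSMod}

/-- Linear maps out of the composite product of linearised `𝕊`-modules are determined by their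
values on two-level trees with basis elements as decorations. -/
theorem lin_comp_hom_ext {S : Type} [Finite S] {M : Type*} [AddCommGroup M] [Module k M]
    {φ ψ : compObj (X.lin k) (Y.lin k) S →ₗ[k] M}
    (h : ∀ (r : Setoid S) (x : X.obj (Quotient r)) (y : ∀ b, Y.obj (Fib (Quotient.mk r) b)),
      φ (tree (P := X.lin k) (Q := Y.lin k) (Quotient.mk r) Quotient.mk_surjective
        (Finsupp.single x 1) fun b => Finsupp.single (y b) 1) =
      ψ (tree (P := X.lin k) (Q := Y.lin k) (Quotient.mk r) Quotient.mk_surjective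
        (Finsupp.single x 1) fun b => Finsupp.single (y b) 1)) : φ = ψ := by
  refine DirectSum.linearMap_ext _ fun r => TensorProduct.ext (Finsupp.lhom_ext' fun x =>
    LinearMap.ext_ring (PiTensorProduct.ext (Module.Basis.ext_multilinear
      (fun b => Finsupp.basisSingleOne (R := k) (ι := Y.obj (Fib (Quotient.mk r) b)))
      fun y => ?_)))
  have := h r x y
  rw [tree_mk] at this
  simpa using this

theorem lmapDomain_natural (f : ∀ (S : Type) [Finite S], X.obj S → Y.obj S)
    (hf : ∀ {S T : Type} [Finite S] [Finite T] (e : S ≃ T) (x : X.obj S),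
      f T (X.map e x) = Y.map e (f S x)) :
    IsNatural (P := X.lin k) (Q := Y.lin k) fun S _ => Finsupp.lmapDomain k k (f S) := by
  intro S T _ _ e x
  simp only [Finsupp.lmapDomain_apply, ← Finsupp.mapDomain_comp]
  congr 1
  exact funext (hf e)

/-- Basis trees span the source, so multiplicativity of a linearised map has to be checked on basis
elements only. -/
theorem lmapDomain_linMul (f : ∀ (S : Type) [Finite S], X.obj S → Y.obj S)
    {F : ∀ (S : Type) [Finite S] (r : Setoid S), X.obj (Quotient r) →
      (∀ b, X.obj (Fib (Quotient.mk r) b)) → (X.obj S →₀ k)}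
    {F' : ∀ (S : Type) [Finite S] (r : Setoid S), Y.obj (Quotient r) →
      (∀ b, Y.obj (Fib (Quotient.mk r) b)) → (Y.obj S →₀ k)}
    (S : Type) [Finite S]
    (hF : ∀ r x y, Finsupp.mapDomain (f S) (F S r x y) = F' S r (f _ x) fun b => f _ (y b))
    (x : (comp (X.lin k) (X.lin k)).obj S) :
    Finsupp.lmapDomain k k (f S) (X.linMul k F S x) =
      Y.linMul k F' S (hcomp (P := X.lin k) (P' := Y.lin k) (Q := X.lin k) (Q' := Y.lin k)
        (fun S _ => Finsupp.lmapDomain k k (f S)) (fun S _ => Finsupp.lmapDomain k k (f S)) S x) := by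
  let φ : Fam (X.lin k) (Y.lin k) := fun S _ => Finsupp.lmapDomain k k (f S)
  refine LinearMap.congr_fun (f := φ S ∘ₗ X.linMul k F S)
    (g := Y.linMul k F' S ∘ₗ hcomp φ φ S) (lin_comp_hom_ext fun r x y => ?_) x
  rw [LinearMap.comp_apply, LinearMap.comp_apply, linMul_tree, hcomp_tree_mk]
  refine (hF r x y).trans ((linMul_tree Y F' S r _ _).symm.trans ?_)
  simp [φ]

end SetSMod

/-! ### Disjoint unions, connectedness and components -/

namespace DGraph

variable {S : Type}

/-- The disjoint union of graphs on the classes of an equivalence relation. -/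
def union (r : Setoid S) (h : ∀ b, DGraph (Fib (Quotient.mk r) b)) (hS : Nonempty S) :
    DGraph S where
  Adj x y := ∃ e : Quotient.mk r x = Quotient.mk r y, (h (Quotient.mk r y)).Adj ⟨x, e⟩ ⟨y, rfl⟩
  -- There are no edges between different classes, so the contraction is empty, and each restriction
  -- is one of the given acyclic graphs.
  acyclic := by
    refine acyclic_of_quotRel (Quotient.mk r) (fun b hb => ?_) fun b => ?_
    · obtain ⟨b', -, h1, x, y, rfl, rfl, e, -⟩ := Relation.TransGen.tail'_iff.1 hb
      exact h1 e
    · refine fun x hx => (h b).acyclic x (Relation.TransGen.mono ?_ x x hx)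
      rintro x ⟨y, rfl⟩ ⟨_, hxy⟩
      exact hxy
  nonempty := hS

/-- Without edges at the root there is nothing to distribute between the classes, so the sum of
composites has a single term. -/
theorem isComposite_edgeless_iff {r : Setoid S} {h : ∀ b, DGraph (Fib (Quotient.mk r) b)}
    {G : DGraph S} {hr : Nonempty (Quotient r)} :
    IsComposite r (edgeless (Quotient r) hr) h G ↔ G = union r h G.nonempty := by
  rw [isComposite_iff]
  constructor
  · rintro ⟨h1, h2⟩
    ext x y
    constructor
    · intro hxy
      have e : Quotient.mk r x = Quotient.mk r y := by
        by_contra e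
        have : (edgeless (Quotient r) hr).Adj (Quotient.mk r x) (Quotient.mk r y) := by
          rw [h1]
          exact ⟨e, x, y, rfl, rfl, hxy⟩
        exact this
      refine ⟨e, ?_⟩
      rw [h2]
      exact hxy
    · rintro ⟨e, hxy⟩
      rw [h2] at hxy
      exact hxy
  · intro hG
    rw [hG]
    constructor
    · funext b b'
      refine propext ⟨fun h => h.elim, ?_⟩
      rintro ⟨hb, x, y, rfl, rfl, e, -⟩
      exact hb e
    · intro b
      funext x ⟨y, hy⟩
      subst hy
      exact propext ⟨fun h => ⟨x.2, h⟩, fun ⟨_, h⟩ => h⟩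

/-- A path in the connected graph on the common class of `x` and `y` is also a path in `G`. Only the
inclusion of edges is assumed, so that this applies both to composites and to disjoint unions. -/
theorem reachable_of_connected_fib {r : Setoid S} {h : ∀ b, DGraph (Fib (Quotient.mk r) b)}
    {G : DGraph S} (hG : ∀ b x y, (h b).Adj x y → G.Adj x.1 y.1) (hc : ∀ b, (h b).Connected)
    {x y : S} (e : Quotient.mk r x = Quotient.mk r y) :
    (SimpleGraph.fromRel G.Adj).Reachable x y := by
  let φ : SimpleGraph.fromRel (h (Quotient.mk r y)).Adj →g SimpleGraph.fromRel G.Adj :=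
    ⟨Subtype.val, fun {a b} hab => by
      rw [SimpleGraph.fromRel_adj] at hab ⊢
      exact ⟨fun e => hab.1 (Subtype.ext e), hab.2.imp (hG _ _ _) (hG _ _ _)⟩⟩
  exact ((hc (Quotient.mk r y)).preconnected ⟨x, e⟩ ⟨y, rfl⟩).map φ

/-- A walk in `g` lifts to `G`: each of its edges comes from at least one edge of `G`, and the gaps
between consecutive lifts are bridged inside the connected classes. -/
theorem IsComposite.connected {r : Setoid S} {g : DGraph (Quotient r)}
    {h : ∀ b, DGraph (Fib (Quotient.mk r) b)} {G : DGraph S} (H : IsComposite r g h G)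
    (hg : g.Connected) (hc : ∀ b, (h b).Connected) : G.Connected := by
  have hfib : ∀ {x y : S}, Quotient.mk r x = Quotient.mk r y →
      (SimpleGraph.fromRel G.Adj).Reachable x y := fun e =>
    reachable_of_connected_fib (fun b x y => (H.1 b x y).1) hc e
  have key : ∀ b b', (SimpleGraph.fromRel g.Adj).Reachable b b' → ∀ x y, Quotient.mk r x = b →
      Quotient.mk r y = b' → (SimpleGraph.fromRel G.Adj).Reachable x y := by
    rintro b b' ⟨w⟩
    induction w with
    | nil =>
      rintro x y rfl e
      exact hfib e.symm
    | cons hadj _ ih =>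
      rintro x y rfl e
      rw [SimpleGraph.fromRel_adj] at hadj
      obtain ⟨hne, hadj | hadj⟩ := hadj
      · obtain ⟨x', y', hx, rfl, hxy⟩ := (H.2 _ _ hne).1 hadj
        refine (hfib hx.symm).trans (SimpleGraph.Reachable.trans ?_ (ih y' y rfl e))
        refine SimpleGraph.Adj.reachable ((SimpleGraph.fromRel_adj _ _ _).2 ⟨?_, Or.inl hxy⟩)
        rintro rfl
        exact hne hx.symm
      · obtain ⟨y', x', rfl, hx, hxy⟩ := (H.2 _ _ hne.symm).1 hadj
        refine (hfib hx.symm).trans (SimpleGraph.Reachable.trans ?_ (ih y' y rfl e))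
        refine SimpleGraph.Adj.reachable ((SimpleGraph.fromRel_adj _ _ _).2 ⟨?_, Or.inr hxy⟩)
        rintro rfl
        exact hne hx.symm
  exact (SimpleGraph.connected_iff _).2
    ⟨fun x y => key _ _ (hg.preconnected _ _) x y rfl rfl, G.nonempty⟩

/-- The partition of the vertices into connected components. -/
abbrev components (G : DGraph S) : Setoid S := (SimpleGraph.fromRel G.Adj).reachableSetoid

/-- The connected component of a graph, as a graph. -/
def component (G : DGraph S) (b : Quotient G.components) :
    DGraph (Fib (Quotient.mk G.components) b) where
  Adj := fibRel (Quotient.mk G.components) G.Adj b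
  acyclic := Acyclic.comap G.acyclic Subtype.val
  nonempty := (Quotient.mk_surjective b).elim fun s hs => ⟨⟨s, hs⟩⟩

/-- All vertices of a walk lie in one component, so a walk in `G` between two points of a component
is a walk of that component. -/
theorem component_connected (G : DGraph S) (b : Quotient G.components) :
    (G.component b).Connected := by
  have key : ∀ x y, (SimpleGraph.fromRel G.Adj).Reachable x y → ∀ hx hy,
      (SimpleGraph.fromRel (G.component b).Adj).Reachable ⟨x, hx⟩ ⟨y, hy⟩ := by
    rintro x y ⟨w⟩
    induction w with
    | nil => exact fun _ _ => .rfl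
    | @cons x z y hadj w ih =>
      intro hx hy
      have hz : Quotient.mk G.components z = b := hx ▸ Quotient.sound hadj.reachable.symm
      refine SimpleGraph.Reachable.trans (SimpleGraph.Adj.reachable ?_) (ih hz hy)
      rw [SimpleGraph.fromRel_adj] at hadj ⊢
      exact ⟨fun e => hadj.1 (congrArg Subtype.val e), hadj.2⟩
  exact (SimpleGraph.connected_iff _).2 ⟨fun x y =>
    key _ _ (Quotient.exact (x.2.trans y.2.symm)) _ _, (G.component b).nonempty⟩

theorem union_component (G : DGraph S) : union G.components G.component G.nonempty = G := by
  ext x y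
  refine ⟨fun ⟨_, h⟩ => h, fun h => ⟨Quotient.sound (SimpleGraph.Adj.reachable ?_), h⟩⟩
  rw [SimpleGraph.fromRel_adj]
  refine ⟨?_, Or.inl h⟩
  rintro rfl
  exact G.not_adj_self _ h

/-- Edges of the union stay within a class, and each class is connected. With `union_component` this
makes cutting into components inverse to disjoint union. -/
theorem components_union {r : Setoid S} {h : ∀ b, DGraph (Fib (Quotient.mk r) b)}
    {hS : Nonempty S} (hc : ∀ b, (h b).Connected) : (union r h hS).components = r := by
  ext x y
  constructor
  · rintro ⟨w⟩
    induction w with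
    | nil => exact r.refl _
    | cons hadj _ ih =>
      rw [SimpleGraph.fromRel_adj] at hadj
      refine r.trans ?_ ih
      rcases hadj.2 with ⟨e, -⟩ | ⟨e, -⟩
      · exact Quotient.exact e
      · exact Quotient.exact e.symm
  · intro hxy
    refine reachable_of_connected_fib (fun b x y hxy => ?_) hc (Quotient.sound hxy)
    obtain ⟨y, rfl⟩ := y
    exact ⟨x.2, hxy⟩

end DGraph

/-! ### The two suboperads -/

theorem comToNcGra_hom : IsOperadHom (Com k) (LieNcGra k) (comToNcGra k) where
  natural := SetSMod.lmapDomain_natural (X := comSet) (Y := ncGraSet)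
    (fun S _ x => DGraph.edgeless S x.down) fun _ _ => rfl
  map_mul S _ x := by
    refine SetSMod.lmapDomain_linMul (X := comSet) (Y := ncGraSet)
      (fun S _ x => DGraph.edgeless S x.down)
      (F := fun _ _ _ x _ => Finsupp.single ⟨x.down.map Quotient.out⟩ 1)
      (F' := fun S _ r g h => sumOf k (X := DGraph S) fun G => DGraph.IsComposite r g h G)
      S (fun r x y => ?_) x
    refine Finsupp.mapDomain_single.trans (Finsupp.ext fun G => ?_)
    refine Finsupp.single_apply.trans (if_congr ?_ rfl rfl)
    refine Iff.trans ?_ DGraph.isComposite_edgeless_iff.symm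
    -- The only composite of edgeless graphs is their disjoint union, which is edgeless.
    have h : DGraph.union r (fun b => DGraph.edgeless _ (y b).down) G.nonempty =
        DGraph.edgeless S G.nonempty := by
      ext _ _
      exact ⟨fun ⟨_, h⟩ => h, fun h => h.elim⟩
    refine ⟨fun e => e.symm.trans h.symm, fun e => ?_⟩
    exact (e.trans h).symm
  map_one S _ x := by
    refine LinearMap.congr_fun (f := comToNcGra k S ∘ₗ (Com k).one S) (g := (LieNcGra k).one S)
      (unit_hom_ext fun s => ?_) x
    rw [lieNcGra_one_unitGen]
    exact (congrArg (comToNcGra k S) Finsupp.mapDomain_single).trans Finsupp.mapDomain_single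

theorem comToNcGra_injective (S : Type) [Finite S] : Function.Injective (comToNcGra k S) :=
  Finsupp.mapDomain_injective fun ⟨_⟩ ⟨_⟩ _ => rfl

theorem graToNcGra_injective (S : Type) [Finite S] : Function.Injective (graToNcGra k S) :=
  Finsupp.mapDomain_injective Subtype.val_injective

theorem graToNcGra_hom : IsOperadHom (LieGra k) (LieNcGra k) (graToNcGra k) where
  natural := SetSMod.lmapDomain_natural (X := graSet) (Y := ncGraSet)
    (fun S _ x => x.1) fun _ _ => rfl
  map_mul S _ x := by
    refine SetSMod.lmapDomain_linMul (X := graSet) (Y := ncGraSet)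
      (fun S _ x => x.1)
      (F := fun S _ r g h => sumOf k (X := {g : DGraph S // g.Connected}) fun G =>
        DGraph.IsComposite r g.1 (fun b => (h b).1) G.1)
      (F' := fun S _ r g h => sumOf k (X := DGraph S) fun G => DGraph.IsComposite r g h G)
      S (fun r g h => ?_) x
    refine Finsupp.ext fun G => ?_
    by_cases hG : DGraph.Connected G
    · exact Finsupp.mapDomain_apply Subtype.val_injective _ ⟨G, hG⟩
    -- A disconnected graph has coefficient zero on both sides: it is not in the image of the
    -- inclusion, and it is not a composite of connected graphs.
    · refine (Finsupp.mapDomain_of_notMem_range _ _ ?_).trans (if_neg fun H => ?_).symm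
      · rintro ⟨G, rfl⟩
        exact hG G.2
      · exact hG (DGraph.IsComposite.connected H g.2 fun b => (h b).2)
  map_one S _ x := by
    refine LinearMap.congr_fun (f := graToNcGra k S ∘ₗ (LieGra k).one S) (g := (LieNcGra k).one S)
      (unit_hom_ext fun s => ?_) x
    rw [lieNcGra_one_unitGen]
    exact (congrArg (graToNcGra k S) Finsupp.mapDomain_single).trans Finsupp.mapDomain_single

/-! ### The isomorphism `Com ∘ Lie-gra ≅ Lie-ncgra` -/

/-- A two-level tree with a commutative product at the root and connected graphs above it. -/
def comGraTree (k : Type u) [Field k] {S : Type} [Finite S] (r : Setoid S)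
    (x : comSet.obj (Quotient r)) (h : ∀ b, graSet.obj (Fib (Quotient.mk r) b)) :
    (comp (Com k).toSMod (LieGra k).toSMod).obj S :=
  tree (P := comSet.lin k) (Q := graSet.lin k) (Quotient.mk r) Quotient.mk_surjective
    (Finsupp.single x 1) fun b => Finsupp.single (h b) 1

theorem comGraToNcGra_tree {S : Type} [Finite S] (r : Setoid S)
    (x : comSet.obj (Quotient r)) (h : ∀ b, graSet.obj (Fib (Quotient.mk r) b))
    (hS : Nonempty S) :
    comGraToNcGra k S (comGraTree k r x h) = graphElt k (DGraph.union r (fun b => (h b).1) hS) := by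
  have h1 : hcomp (comToNcGra k) (graToNcGra k) S (comGraTree k r x h) =
      tree (P := ncGraSet.lin k) (Q := ncGraSet.lin k) (Quotient.mk r) Quotient.mk_surjective
        (Finsupp.single (DGraph.edgeless _ x.down) 1) fun b => Finsupp.single (h b).1 1 := by
    refine (hcomp_tree_mk (comToNcGra k) (graToNcGra k) r _ _).trans ?_
    have h2 : comToNcGra k (Quotient r) (Finsupp.single x 1 : PLift (Nonempty (Quotient r)) →₀ k) =
        (Finsupp.single (DGraph.edgeless _ x.down) 1 : DGraph (Quotient r) →₀ k) :=
      Finsupp.mapDomain_single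
    have h3 : ∀ b, graToNcGra k (Fib (Quotient.mk r) b) (Finsupp.single (h b) 1 :
        {g : DGraph (Fib (Quotient.mk r) b) // g.Connected} →₀ k) =
        (Finsupp.single (h b).1 1 : DGraph (Fib (Quotient.mk r) b) →₀ k) :=
      fun b => Finsupp.mapDomain_single
    exact congrArg₂ _ h2 (funext h3)
  refine (congrArg ((LieNcGra k).mul S) h1).trans ?_
  refine (SetSMod.linMul_tree ncGraSet (fun S _ r g h =>
    sumOf k (X := DGraph S) fun G => DGraph.IsComposite r g h G) S r _ _).trans (Finsupp.ext fun G => ?_)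
  refine Eq.trans (if_congr ?_ rfl rfl) Finsupp.single_apply.symm
  exact DGraph.isComposite_edgeless_iff.trans ⟨Eq.symm, Eq.symm⟩

/-- The decomposition of graphs into their connected components. -/
def ncGraToComGra (k : Type u) [Field k] (S : Type) [Finite S] :
    (LieNcGra k).toSMod.obj S →ₗ[k] (comp (Com k).toSMod (LieGra k).toSMod).obj S :=
  Finsupp.linearCombination k fun G : DGraph S => comGraTree k G.components
    ⟨G.nonempty.map (Quotient.mk _)⟩ fun b => ⟨G.component b, G.component_connected b⟩

theorem ncGraToComGra_graphElt {S : Type} [Finite S] (G : DGraph S) :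
    ncGraToComGra k S (graphElt k G) = comGraTree k G.components
      ⟨G.nonempty.map (Quotient.mk _)⟩ fun b => ⟨G.component b, G.component_connected b⟩ :=
  (Finsupp.linearCombination_single _ _ _).trans (one_smul _ _)

/-- The decorations live on the classes of two partitions that are only propositionally equal. With
the equality as a hypothesis about a variable `r`, substitution makes them comparable. -/
theorem comGraTree_components {S : Type} [Finite S] (G : DGraph S) (r : Setoid S)
    (x : comSet.obj (Quotient r)) (h : ∀ b, graSet.obj (Fib (Quotient.mk r) b))
    (hr : G.components = r) (hG : ∀ b, (h b).1.Adj = fibRel (Quotient.mk r) G.Adj b) :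
    comGraTree k G.components ⟨G.nonempty.map (Quotient.mk _)⟩
      (fun b => ⟨G.component b, G.component_connected b⟩) = comGraTree k r x h := by
  subst hr
  congr 1
  funext b
  exact Subtype.ext (DGraph.ext (hG b).symm)

/-- A graph amounts to a partition of its vertices with a connected graph on each class. On basis
elements the two maps are disjoint union and decomposition into components, which are mutually
inverse. -/
theorem comGraToNcGra_bijective (S : Type) [Finite S] :
    Function.Bijective (comGraToNcGra k S) := by
  have h1 : ncGraToComGra k S ∘ₗ comGraToNcGra k S = LinearMap.id := by
    refine SetSMod.lin_comp_hom_ext (X := comSet) (Y := graSet) fun r x h => ?_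
    have hS : Nonempty S := x.down.map Quotient.out
    change ncGraToComGra k S (comGraToNcGra k S (comGraTree k r x h)) = comGraTree k r x h
    rw [comGraToNcGra_tree r x h hS, ncGraToComGra_graphElt]
    refine comGraTree_components _ r x h (DGraph.components_union fun b => (h b).2) fun b => ?_
    funext x ⟨y, hy⟩
    subst hy
    exact propext ⟨fun h => ⟨x.2, h⟩, fun ⟨_, h⟩ => h⟩
  have h2 : comGraToNcGra k S ∘ₗ ncGraToComGra k S = LinearMap.id := by
    refine Finsupp.lhom_ext' fun G : DGraph S => LinearMap.ext_ring ?_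
    change comGraToNcGra k S (ncGraToComGra k S (graphElt k G)) = graphElt k G
    rw [ncGraToComGra_graphElt]
    exact (comGraToNcGra_tree _ _ _ G.nonempty).trans (congrArg _ G.union_component)
  exact ⟨Function.LeftInverse.injective (g := ncGraToComGra k S) fun x =>
    LinearMap.congr_fun h1 x, Function.RightInverse.surjective (g := ncGraToComGra k S) fun x =>
    LinearMap.congr_fun h2 x⟩

/-! ### The exchange map and the main theorem -/

/-- The distributive law of connected graphs over commutative products. -/
def graComExchange (k : Type u) [Field k] : Fam (comp (LieGra k).toSMod (Com k).toSMod)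
    (comp (Com k).toSMod (LieGra k).toSMod) := fun S _ =>
  (LinearEquiv.ofBijective (comGraToNcGra k S) (comGraToNcGra_bijective S)).symm.toLinearMap ∘ₗ
    graComToNcGra k S

theorem comGraToNcGra_exchange (S : Type) [Finite S]
    (x : (comp (LieGra k).toSMod (Com k).toSMod).obj S) :
    comGraToNcGra k S (graComExchange k S x) = graComToNcGra k S x :=
  (LinearEquiv.ofBijective (comGraToNcGra k S) (comGraToNcGra_bijective S)).apply_symm_apply _

theorem famMul_comp_exchange : famComp (famMul (LieNcGra k) (comToNcGra k) (graToNcGra k))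
    (graComExchange k) = famMul (LieNcGra k) (graToNcGra k) (comToNcGra k) := by
  funext S _
  exact LinearMap.ext fun x => comGraToNcGra_exchange S x

theorem comGraToNcGra_isOperadIso :
    IsOperadIso (compositeOperad (Com k) (LieGra k) (graComExchange k)) (LieNcGra k)
      (comGraToNcGra k) where
  toIsOperadHom := compositeOperad_hom lieNcGra_isOperad comToNcGra_hom graToNcGra_hom
    famMul_comp_exchange
  bijective S _ := comGraToNcGra_bijective S

end
end GraphOperad

theorem mainTheorem10 (k : Type*) [Field k] [CharZero k] :
    -- the graphs form operads, with the stated partial compositions and units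
    GraphOperad.IsOperad (GraphOperad.LieNcGra k) ∧
    GraphOperad.IsOperad (GraphOperad.LieGra k) ∧
    GraphOperad.IsOperad (GraphOperad.Com k) ∧
    (∀ (S T : Type) [Finite S] [Finite T] [Nonempty T] (a : S)
      (g : GraphOperad.DGraph S) (h : GraphOperad.DGraph T),
      (GraphOperad.LieNcGra k).circ a (Finsupp.single g 1) (Finsupp.single h 1) =
        GraphOperad.sumOf k fun G => GraphOperad.DGraph.IsInsertion a g h G) ∧
    -- `Com` and `Lie-gra` are suboperads
    GraphOperad.IsOperadHom (GraphOperad.Com k) (GraphOperad.LieNcGra k)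
      (GraphOperad.comToNcGra k) ∧
    (∀ (S : Type) [Finite S], Function.Injective (GraphOperad.comToNcGra k S)) ∧
    GraphOperad.IsOperadHom (GraphOperad.LieGra k) (GraphOperad.LieNcGra k)
      (GraphOperad.graToNcGra k) ∧
    (∀ (S : Type) [Finite S], Function.Injective (GraphOperad.graToNcGra k S)) ∧
    -- the induced distributive law and its composite operad
    ∃ Λ : GraphOperad.SMod.Fam
        (GraphOperad.SMod.comp (GraphOperad.LieGra k).toSMod (GraphOperad.Com k).toSMod)
        (GraphOperad.SMod.comp (GraphOperad.Com k).toSMod (GraphOperad.LieGra k).toSMod),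
      (∀ (S : Type) [Finite S]
        (x : (GraphOperad.SMod.comp (GraphOperad.LieGra k).toSMod
          (GraphOperad.Com k).toSMod).obj S),
        GraphOperad.comGraToNcGra k S (Λ S x) = GraphOperad.graComToNcGra k S x) ∧
      GraphOperad.IsDistributiveLaw (GraphOperad.Com k) (GraphOperad.LieGra k) Λ ∧
      GraphOperad.IsOperad
        (GraphOperad.compositeOperad (GraphOperad.Com k) (GraphOperad.LieGra k) Λ) ∧
      GraphOperad.IsOperadIso
        (GraphOperad.compositeOperad (GraphOperad.Com k) (GraphOperad.LieGra k) Λ)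
        (GraphOperad.LieNcGra k) (GraphOperad.comGraToNcGra k) := by
  open GraphOperad in
  -- Only `Lie-ncgra` is verified directly; the axioms for `Lie-gra`, `Com` and the composite operad
  -- are pulled back along their injective maps into it.
  exact ⟨lieNcGra_isOperad, graToNcGra_hom.isOperad lieNcGra_isOperad graToNcGra_injective,
    comToNcGra_hom.isOperad lieNcGra_isOperad comToNcGra_injective, lieNcGra_circ,
    comToNcGra_hom, comToNcGra_injective, graToNcGra_hom, graToNcGra_injective,
    graComExchange k, comGraToNcGra_exchange,
    isDistributiveLaw_of_injective lieNcGra_isOperad comToNcGra_hom graToNcGra_hom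
      (fun S _ => (comGraToNcGra_bijective S).injective) famMul_comp_exchange,
    comGraToNcGra_isOperadIso.toIsOperadHom.isOperad lieNcGra_isOperad
      fun S _ => (comGraToNcGra_bijective S).injective,
    comGraToNcGra_isOperadIso⟩
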